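/- Let $F$ be a continuous distribution function with $F(0)=0$ and $F(y)\sim Cy^a$ as $y\downarrow 0$ for some constants $a,C>0$. Let $G$ be the measure on $[0,\infty)$ with $G([0,x])=-\ln(1-F(x))$ for $x\ge 0$ (equal to $\infty$ if $F(x)=1$). Then there are probability distributions $I_s$ on $[0,1]$, $s>0$, depending on $F$ only, such that the following holds. (i) If $s>0$ and $F(s)<1$, the cdf of $I_s$ is $$ I_s(b)=\frac{(1-b)\,G([0,sb])+\int_0^b G([0,st])\,dt}{\int_0^1 G([0,st])\,dt},\qquad 0\le b\le 1. $$ (ii) Let $n\ge 1$ be an integer, let $\Phi_n$ be a Poisson point process on $\mathbb{R}_+^2$ with intensity measure $n\lambda\times G$ ($\lambda$ is Lebesgue measure), and let $0<w\le\infty$ and $h>0$ with $F(h)<1$. Let $V_0,V_1,\dots$ be the vertices, listed by decreasing height, of the lower left convex hull of the points of $\Phi_n$ in $(0,w)\times(0,h)$; that is, the points which are the unique minimizer of $x+\alpha y$ among these points for some $\alpha>0$. Write $y(V)$ for the height of $V$. For $i\ge 1$ let $E_i$ be the event that $V_{i-1}$ and $V_i$ exist and that the line through them meets the $x$-axis at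 an abscissa less than $w$, and on $E_i$ put $B_i=y(V_i)/y(V_{i-1})$. Then, conditionally on $E_i$, the conditional distribution of $B_i$ given $y(V_{i-1})=s$ is $I_s$, for almost every $s$ with respect to the law of $y(V_{i-1})$ given $E_i$. If $w=\infty$, then almost surely $V_i$ exists for every $i$ and $E_i$ occurs, so that simply $\mathbb{P}(B_i\le b\mid y(V_{i-1})=s)=I_s(b)$. (iii) As $s\downarrow 0$, $I_s$ converges in distribution to $\mathrm{Beta}(a,2)$. -/

import Mathlib

open MeasureTheory ProbabilityTheory Set Filter Topology Asymptotics
open scoped ENNReal NNReal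

noncomputable section

/-- The measure `G` on `[0, ∞)` with `G [0, x] = -log (1 - F x)`, where `F` is the distribution
function of a probability measure `μ` on `(0, ∞)`. It is built as the image of Lebesgue measure on
`(0, ∞)` under `t ↦ F⁻¹ (1 - exp (-t))`; the defining property is `hazardMeasure_Icc`. -/
def hazardMeasure (μ : Measure ℝ) : Measure ℝ :=
  (volume.restrict (Ioi (0 : ℝ))).map (fun t => sInf {x : ℝ | 1 - Real.exp (-t) ≤ cdf μ x})

theorem quantile_le_iff (μ : Measure ℝ) {u x : ℝ} (h0 : 0 < u) (h1 : u < 1) :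
    sInf {y : ℝ | u ≤ cdf μ y} ≤ x ↔ u ≤ cdf μ x := by
  have hne : {y : ℝ | u ≤ cdf μ y}.Nonempty := by
    obtain ⟨y, hy⟩ := ((tendsto_cdf_atTop μ).eventually (lt_mem_nhds h1)).exists
    exact ⟨y, hy.le⟩
  have hbdd : BddBelow {y : ℝ | u ≤ cdf μ y} := by
    obtain ⟨z, hz⟩ := ((tendsto_cdf_atBot μ).eventually (gt_mem_nhds h0)).exists
    refine ⟨z, fun y hy => ?_⟩
    by_contra hlt
    have := monotone_cdf μ (not_le.1 hlt).le
    exact absurd (lt_of_le_of_lt (le_trans hy this) hz) (lt_irrefl _)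
  constructor
  · intro h
    have key : ∀ y, x < y → u ≤ cdf μ y := by
      intro y hy
      obtain ⟨z, hz, hzy⟩ := exists_lt_of_csInf_lt hne (lt_of_le_of_lt h hy)
      exact le_trans hz (monotone_cdf μ hzy.le)
    have hr : Tendsto (cdf μ) (𝓝[>] x) (𝓝 (cdf μ x)) :=
      ((cdf μ).right_continuous x).mono_left (nhdsWithin_mono _ Ioi_subset_Ici_self)
    exact ge_of_tendsto hr (eventually_nhdsWithin_of_forall key)
  · intro h
    exact csInf_le hbdd h

theorem hazardMeasure_Icc (μ : Measure ℝ) (x : ℝ) (h0 : cdf μ 0 = 0) :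
    hazardMeasure μ (Icc 0 x) =
      if cdf μ x < 1 then ENNReal.ofReal (-Real.log (1 - cdf μ x)) else ∞ := by
  have hu : ∀ t : ℝ, 0 < t → 0 < 1 - Real.exp (-t) ∧ 1 - Real.exp (-t) < 1 := by
    intro t ht
    have h1 : Real.exp (-t) < 1 := by simpa using ht
    have h2 := Real.exp_pos (-t)
    constructor <;> linarith
  have hmono : MonotoneOn (fun t => sInf {x : ℝ | 1 - Real.exp (-t) ≤ cdf μ x}) (Ioi 0) := by
    intro s hs t ht hst
    have hs' := hu s hs
    have ht' := hu t ht
    refine (quantile_le_iff μ hs'.1 hs'.2).2 ?_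
    have h1 := (quantile_le_iff μ ht'.1 ht'.2).1 le_rfl
    have h2 : Real.exp (-t) ≤ Real.exp (-s) := Real.exp_le_exp.2 (by linarith)
    linarith
  have hm : AEMeasurable (fun t => sInf {x : ℝ | 1 - Real.exp (-t) ≤ cdf μ x})
      (volume.restrict (Ioi (0 : ℝ))) :=
    aemeasurable_restrict_of_monotoneOn measurableSet_Ioi hmono
  rw [hazardMeasure, Measure.map_apply_of_aemeasurable hm measurableSet_Icc,
    Measure.restrict_apply₀' measurableSet_Ioi.nullMeasurableSet]
  have hset : (fun t => sInf {x : ℝ | 1 - Real.exp (-t) ≤ cdf μ x}) ⁻¹' Icc 0 x ∩ Ioi 0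
      = {t : ℝ | 0 < t ∧ 1 - Real.exp (-t) ≤ cdf μ x} := by
    ext t
    simp only [mem_inter_iff, mem_preimage, mem_Icc, mem_Ioi, mem_ofPred_eq]
    constructor
    · rintro ⟨⟨-, h⟩, ht⟩
      exact ⟨ht, (quantile_le_iff μ (hu t ht).1 (hu t ht).2).1 h⟩
    · rintro ⟨ht, h⟩
      refine ⟨⟨?_, (quantile_le_iff μ (hu t ht).1 (hu t ht).2).2 h⟩, ht⟩
      by_contra hneg
      have := (quantile_le_iff μ (hu t ht).1 (hu t ht).2).1 (not_le.1 hneg).le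
      linarith [(hu t ht).1]
  rw [hset]
  split_ifs with hF
  · have : {t : ℝ | 0 < t ∧ 1 - Real.exp (-t) ≤ cdf μ x} = Ioc 0 (-Real.log (1 - cdf μ x)) := by
      ext t
      have hiff : Real.log (1 - cdf μ x) ≤ -t ↔ 1 - cdf μ x ≤ Real.exp (-t) :=
        Real.log_le_iff_le_exp (by linarith)
      simp only [mem_ofPred_eq, mem_Ioc]
      constructor
      · rintro ⟨ht, h⟩
        exact ⟨ht, by linarith [hiff.2 (by linarith)]⟩
      · rintro ⟨ht, h⟩
        exact ⟨ht, by linarith [hiff.1 (by linarith)]⟩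
    rw [this, Real.volume_Ioc, sub_zero]
  · have : {t : ℝ | 0 < t ∧ 1 - Real.exp (-t) ≤ cdf μ x} = Ioi 0 := by
      ext t
      simp only [mem_ofPred_eq, mem_Ioi, and_iff_left_iff_imp]
      intro ht
      linarith [(hu t ht).2]
    rw [this, Real.volume_Ioi]

/-- The Poisson law with mean `r ∈ [0, ∞]`; for `r = ∞` it is the point mass at `∞`. -/
def poissonLaw (r : ℝ≥0∞) : Measure ℕ∞ :=
  if r = ∞ then Measure.dirac ⊤ else (poissonMeasure r.toNNReal).map (fun k : ℕ => (k : ℕ∞))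

/-- `Φ` is a (simple) Poisson point process with intensity measure `Λ`, given as a random set. -/
structure IsPoissonPointProcess {Ω E : Type*} [MeasurableSpace Ω] [MeasurableSpace E]
    (Φ : Ω → Set E) (Λ : Measure E) (P : Measure Ω) : Prop where
  measurable_count : ∀ B : Set E, MeasurableSet B → Measurable (fun ω => (Φ ω ∩ B).encard)
  hasLaw_count : ∀ B : Set E, MeasurableSet B →
    HasLaw (fun ω => (Φ ω ∩ B).encard) (poissonLaw (Λ B)) P
  indep_count : ∀ (m : ℕ) (B : Fin m → Set E), (∀ k, MeasurableSet (B k)) →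
    Pairwise (fun k l => Disjoint (B k) (B l)) →
    iIndepFun (fun k ω => (Φ ω ∩ B k).encard) P

/-- The window `(0, w) × (0, h)`; `w = ∞` is allowed. -/
def window (w : EReal) (h : ℝ) : Set (ℝ × ℝ) :=
  {p | 0 < p.1 ∧ (p.1 : EReal) < w ∧ 0 < p.2 ∧ p.2 < h}

/-- The vertices of the lower left convex hull of `S`: the points of `S` that are the only point
of `S` on a supporting line with normal vector `(1, α)`, `α > 0`, below which there is no point
of `S`. -/
def lowerLeftVertices (S : Set (ℝ × ℝ)) : Set (ℝ × ℝ) :=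
  {p | p ∈ S ∧ ∃ α : ℝ, 0 < α ∧ ∀ q ∈ S, q ≠ p → p.1 + α * p.2 < q.1 + α * q.2}

/-- `p` is the vertex number `i` (starting from `0`) of the lower left hull of `S`, the vertices
being listed by decreasing height. -/
def IsVertexAt (S : Set (ℝ × ℝ)) (i : ℕ) (p : ℝ × ℝ) : Prop :=
  p ∈ lowerLeftVertices S ∧ {q | q ∈ lowerLeftVertices S ∧ p.2 < q.2}.encard = i

open Classical in
/-- The height of the vertex number `i` (zero if there are at most `i` vertices). -/
def vertexHeight (S : Set (ℝ × ℝ)) (i : ℕ) : ℝ :=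
  if hp : ∃ p, IsVertexAt S i p then hp.choose.2 else 0

/-- The abscissa at which the line through `p` and `q` meets the `x`-axis. -/
def xIntercept (p q : ℝ × ℝ) : ℝ :=
  p.1 + p.2 * (q.1 - p.1) / (p.2 - q.2)

/-- The vertices number `i` and `i + 1` exist, and the line through them meets the `x`-axis to the
left of `w`. -/
def HasStepWithin (S : Set (ℝ × ℝ)) (w : EReal) (i : ℕ) : Prop :=
  ∃ p q, IsVertexAt S i p ∧ IsVertexAt S (i + 1) q ∧ (xIntercept p q : EReal) < w

/-- The function `I_s(b)`. -/
def stepCDF (G : Measure ℝ) (s b : ℝ) : ℝ :=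
  ((1 - b) * G.real (Icc 0 (s * b)) + ∫ t in (0 : ℝ)..b, G.real (Icc 0 (s * t))) /
    ∫ t in (0 : ℝ)..1, G.real (Icc 0 (s * t))

end

/-! Look at the next vertex `q = (x, y)` after a vertex `p` of height `s` through the inverse slope
`α = (x - p.1) / (s - y)` of the edge joining them. When `p` and `q` are added to the process, they
are the vertices number `i` and `i + 1` exactly if no point of the process lies below their line and
`p` has `i` vertices above it (`IsLocallyFiniteInStrip.isVertexAt_pair_iff`). The first condition
sees `q` only through `α`. Once it holds, the second does not involve `q`. The abscissa where the
line meets the axis is `p.1 + s * α`, which again sees only `α`.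

In the Mecke formula for pairs, `q` carries the intensity `n dx G(dy)`, and `dx = (s - y) dα` for
fixed `y`. So, given `p`, the variables `α` and `y` separate, and `y` has density proportional to `s
- y` with respect to `G` on `[0, s]`. The parameters `n`, `w`, `h`, `i` and the abscissa `p.1` enter
only the factor that does not involve `y`, apart from the requirement `s < h`. This is
`lintegral_step_eq`; normalizing it gives `condDistrib_height_ratio`.

The cdf follows from Tonelli's theorem and `s - y = s * ((1 - b) + (b - y / s))`
(`stepMeasure_Iic`). As `s ↓ 0`, the equivalence of `-log (1 - u)` and `u` gives `G [0, s t] / G [0,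
s] → t ^ a`, and dominated convergence yields the limit cdf `(a + 1) b ^ a - a b ^ (a + 1)`
(`tendsto_stepCDF`), which is that of Beta(a, 2).

The Mecke formula is derived from the laws of counts. Its seed is `k P(N = k) = r P(N = k - 1)` for
a Poisson variable (`mul_poissonLaw_singleton`); independence extends this to finite partitions, and
finite-dimensional marginals determine the law of the random measure. To apply the formula to the
hull, being vertex number `i` has to be a measurable condition on the counting measure; this is
achieved with rational slopes and s-finite kernels. The description of the hull is used on the
almost sure event that the point set is locally finite. -/

noncomputable section

/-! ### Point sets as counting measures -/

section PointMeasure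

variable {E : Type*} [MeasurableSpace E]

/-- The counting measure of the set `S`, as a sum of Dirac masses. -/
def pointMeasure (S : Set E) : Measure E := Measure.sum fun p : S => Measure.dirac (p : E)

theorem pointMeasure_apply (S : Set E) {B : Set E} (hB : MeasurableSet B) :
    pointMeasure S B = ((S ∩ B).encard : ℝ≥0∞) := by
  rw [pointMeasure, Measure.sum_apply _ hB]
  simp_rw [Measure.dirac_apply' _ hB]
  rw [tsum_subtype S (B.indicator (1 : E → ℝ≥0∞)), Set.indicator_indicator, ← tsum_subtype]
  simp only [Pi.one_apply]
  exact ENNReal.tsum_set_one _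

theorem lintegral_pointMeasure (S : Set E) {f : E → ℝ≥0∞} (hf : Measurable f) :
    ∫⁻ p, f p ∂(pointMeasure S) = ∑' p : S, f p := by
  rw [pointMeasure, lintegral_sum_measure]
  simp_rw [lintegral_dirac' _ hf]

theorem pointMeasure_insert {S : Set E} {p : E} (hp : p ∉ S) :
    pointMeasure (insert p S) = pointMeasure S + Measure.dirac p := by
  ext B hB
  rw [Measure.add_apply, pointMeasure_apply _ hB, pointMeasure_apply _ hB,
    Measure.dirac_apply' _ hB]
  by_cases h : p ∈ B
  · rw [insert_inter_of_mem h, encard_insert_of_notMem (fun h' => hp h'.1)]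
    simp [h]
  · rw [insert_inter_of_notMem h]
    simp [h]

theorem measurable_pointMeasure {Ω : Type*} [MeasurableSpace Ω] {Φ : Ω → Set E}
    (h : ∀ B : Set E, MeasurableSet B → Measurable (fun ω => (Φ ω ∩ B).encard)) :
    Measurable fun ω => pointMeasure (Φ ω) := by
  refine Measure.measurable_of_measurable_coe _ fun B hB => ?_
  simp_rw [pointMeasure_apply _ hB]
  exact (Measurable.of_discrete (f := ENat.toENNReal)).comp (h B hB)

end PointMeasure

/-! ### S-finite kernels, for measurability of integrals against a random measure -/

section SFiniteKernel

variable {α E : Type*} [MeasurableSpace α] [MeasurableSpace E]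

/-- Total masses need not be bounded uniformly in `a`. Splitting the source by the integer part of
the mass gives countably many finite kernels. -/
theorem isSFiniteKernel_of_forall_measure_univ_lt_top (κ : Kernel α E)
    (h : ∀ a, κ a univ < ∞) : IsSFiniteKernel κ := by
  classical
  have hs : ∀ j : ℕ, MeasurableSet {a | ⌊(κ a univ).toReal⌋₊ = j} := fun j =>
    (Nat.measurable_floor.comp (κ.measurable_coe .univ).ennreal_toReal) (measurableSet_singleton j)
  have hk : κ = Kernel.sum fun j : ℕ => Kernel.piecewise (hs j) κ 0 := by
    ext a B hB
    rw [Kernel.sum_apply' _ _ hB, tsum_eq_single ⌊(κ a univ).toReal⌋₊]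
    · rw [Kernel.piecewise_apply, if_pos (by rfl)]
    · intro j hj
      rw [Kernel.piecewise_apply, if_neg (fun h' => hj h'.symm)]
      simp
  rw [hk]
  have hfin : ∀ j, IsFiniteKernel (Kernel.piecewise (hs j) κ 0) := fun j => by
    refine ⟨⟨ENNReal.ofReal (j + 1), ENNReal.ofReal_lt_top, fun a => ?_⟩⟩
    rw [Kernel.piecewise_apply]
    split_ifs with ha
    · rw [ENNReal.le_ofReal_iff_toReal_le (h a).ne (by positivity)]
      have := Nat.lt_floor_add_one (κ a univ).toReal
      rw [show ⌊(κ a univ).toReal⌋₊ = j from ha] at this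
      exact this.le
    · simp
  exact Kernel.isSFiniteKernel_sum

theorem isSFiniteKernel_of_cover (κ : Kernel α E) (S : ℕ → Set E) (hS : ∀ n, MeasurableSet (S n))
    (hcov : ⋃ n, S n = univ) (h : ∀ a n, κ a (S n) < ∞) : IsSFiniteKernel κ := by
  have hd : ∀ n, MeasurableSet (disjointed S n) := fun n => MeasurableSet.disjointed hS n
  have hk : κ = Kernel.sum fun n : ℕ => κ.restrict (hd n) := by
    ext a : 1
    rw [Kernel.sum_apply]
    simp_rw [Kernel.restrict_apply]
    rw [← Measure.restrict_iUnion (disjoint_disjointed S) hd, iUnion_disjointed, hcov,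
      Measure.restrict_univ]
  rw [hk]
  have hfin : ∀ n, IsSFiniteKernel (κ.restrict (hd n)) := fun n => by
    refine isSFiniteKernel_of_forall_measure_univ_lt_top _ fun a => ?_
    rw [Kernel.restrict_apply, Measure.restrict_apply_univ]
    exact (measure_mono (disjointed_subset S n)).trans_lt (h a n)
  exact Kernel.isSFiniteKernel_sum

open Classical in
/-- The identity kernel on the measures that are finite on every `S n`, and zero elsewhere. -/
def locallyFiniteKernel (S : ℕ → Set E) (hS : ∀ n, MeasurableSet (S n)) : Kernel (Measure E) E :=
  Kernel.piecewise (s := {m : Measure E | ∀ n, m (S n) < ∞})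
    (by
      rw [ofPred_forall]
      exact MeasurableSet.iInter fun n =>
        (Measure.measurable_coe (hS n)) measurableSet_Iio) ⟨id, measurable_id⟩ 0

open Classical in
theorem locallyFiniteKernel_apply {S : ℕ → Set E} (hS : ∀ n, MeasurableSet (S n)) {m : Measure E}
    (hm : ∀ n, m (S n) < ∞) : locallyFiniteKernel S hS m = m := by
  rw [locallyFiniteKernel, Kernel.piecewise_apply, if_pos (by exact hm)]
  rfl

open Classical in
-- This is what makes `m ↦ ∫ f(m, q) dm(q)` measurable; the identity on all measures has no such
-- property, so the other measures were sent to zero.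
theorem isSFiniteKernel_locallyFiniteKernel {S : ℕ → Set E} (hS : ∀ n, MeasurableSet (S n))
    (hcov : ⋃ n, S n = univ) : IsSFiniteKernel (locallyFiniteKernel S hS) := by
  refine isSFiniteKernel_of_cover _ S hS hcov fun m n => ?_
  rw [locallyFiniteKernel, Kernel.piecewise_apply]
  split_ifs with h
  · exact h n
  · simp

end SFiniteKernel

/-! ### Poisson counts on finitely many disjoint cells -/

section Poisson

variable {Ω E : Type*} [MeasurableSpace Ω] [MeasurableSpace E]
  {Φ : Ω → Set E} {Λ : Measure E} {P : Measure Ω}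

theorem IsPoissonPointProcess.inter (hΦ : IsPoissonPointProcess Φ Λ P) {W : Set E}
    (hW : MeasurableSet W) : IsPoissonPointProcess (fun ω => Φ ω ∩ W) (Λ.restrict W) P where
  measurable_count B hB := by
    simp_rw [inter_assoc]
    exact hΦ.measurable_count _ (hW.inter hB)
  hasLaw_count B hB := by
    simp_rw [inter_assoc]
    rw [Measure.restrict_apply hB, inter_comm B W]
    exact hΦ.hasLaw_count _ (hW.inter hB)
  indep_count m B hB hd := by
    simp_rw [inter_assoc]
    exact hΦ.indep_count m _ (fun k => hW.inter (hB k))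
      fun k l hkl => (hd hkl).mono inter_subset_right inter_subset_right

theorem IsPoissonPointProcess.iIndepFun_count (hΦ : IsPoissonPointProcess Φ Λ P) {τ : Type*}
    [Fintype τ] {D : τ → Set E} (hD : ∀ t, MeasurableSet (D t))
    (hd : Pairwise fun s t => Disjoint (D s) (D t)) :
    iIndepFun (fun t ω => (Φ ω ∩ D t).encard) P := by
  let e := Fintype.equivFin τ
  have := hΦ.indep_count _ (fun k => D (e.symm k)) (fun k => hD _)
    fun k l hkl => hd (e.symm.injective.ne hkl)
  have h2 := this.precomp (g := e) e.injective
  simpa using h2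

theorem poissonLaw_ofNat {r : ℝ≥0∞} (hr : r ≠ ∞) (k : ℕ) :
    poissonLaw r {(k : ℕ∞)} = ENNReal.ofReal (Real.exp (-r.toReal) * r.toReal ^ k / k.factorial) := by
  rw [poissonLaw, if_neg hr, Measure.map_apply .of_discrete .of_discrete]
  have : (fun k : ℕ => (k : ℕ∞)) ⁻¹' {(k : ℕ∞)} = {k} := by
    ext; simp
  rw [this, poissonMeasure_singleton]
  rfl

theorem poissonLaw_top {r : ℝ≥0∞} (hr : r ≠ ∞) : poissonLaw r {⊤} = 0 := by
  rw [poissonLaw, if_neg hr, Measure.map_apply .of_discrete .of_discrete]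
  have : (fun k : ℕ => (k : ℕ∞)) ⁻¹' {⊤} = ∅ := by
    ext; simp
  rw [this, measure_empty]

/-- The Mecke formula for a single count. Writing the event as `x + 1 = k` avoids subtraction in
`ℕ∞`: it is empty for `k = 0`, and for `k = ⊤` it is the null event `x = ⊤`. -/
theorem mul_poissonLaw_singleton {r : ℝ≥0∞} (hr : r ≠ ∞) (k : ℕ∞) :
    (k : ℝ≥0∞) * poissonLaw r {k} = r * poissonLaw r {x | x + 1 = k} := by
  induction k using ENat.recTopCoe with
  | top =>
    have : {x : ℕ∞ | x + 1 = ⊤} = {⊤} := by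
      ext x; simp
    rw [this, poissonLaw_top hr, mul_zero, mul_zero]
  | coe k =>
    cases k with
    | zero =>
      have : {x : ℕ∞ | x + 1 = (0 : ℕ)} = ∅ := by
        ext x; simp
      rw [this]; simp
    | succ k =>
      have : {x : ℕ∞ | x + 1 = ((k + 1 : ℕ) : ℕ∞)} = {(k : ℕ∞)} := by
        ext x
        simp only [mem_ofPred_eq, mem_singleton_iff, Nat.cast_add, Nat.cast_one]
        exact WithTop.add_right_inj ENat.one_ne_top
      rw [this, poissonLaw_ofNat hr, poissonLaw_ofNat hr]
      nth_rw 3 [← ENNReal.ofReal_toReal hr]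
      rw [← ENNReal.ofReal_mul ENNReal.toReal_nonneg]
      have : (((k + 1 : ℕ) : ℕ∞) : ℝ≥0∞) = ENNReal.ofReal ((k + 1 : ℕ) : ℝ) := by
        rw [ENNReal.ofReal_natCast]
        rfl
      rw [this, ← ENNReal.ofReal_mul (by positivity)]
      congr 1
      rw [Nat.factorial_succ]
      push_cast
      field_simp
      ring

open Classical in
-- By independence the joint law of the counts is a product, and only the factor of the cell `t` is
-- affected by weighting or by adding a point there. The other cells may have infinite mean.
theorem IsPoissonPointProcess.withDensity_count [IsProbabilityMeasure P]
    (hΦ : IsPoissonPointProcess Φ Λ P) {τ : Type*}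
    [Fintype τ] {D : τ → Set E} (hD : ∀ t, MeasurableSet (D t))
    (hd : Pairwise fun s t => Disjoint (D s) (D t)) (t : τ) (ht : Λ (D t) ≠ ∞) :
    (P.map fun ω s => (Φ ω ∩ D s).encard).withDensity (fun k => (k t : ℝ≥0∞)) =
      Λ (D t) • (P.map fun ω s => (Φ ω ∩ D s).encard).map (fun k => k + Pi.single t 1) := by
  have hind := hΦ.iIndepFun_count hD hd
  have hm : ∀ s, Measurable fun ω => (Φ ω ∩ D s).encard := fun s => hΦ.measurable_count _ (hD s)
  have hK : Measurable fun ω s => (Φ ω ∩ D s).encard := measurable_pi_lambda _ hm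
  have hlaw : ∀ s (A : Set ℕ∞), P ((fun ω => (Φ ω ∩ D s).encard) ⁻¹' A) = poissonLaw (Λ (D s)) A :=
    fun s A => by
      rw [← (hΦ.hasLaw_count _ (hD s)).map_eq, Measure.map_apply (hm s) .of_discrete]
  refine Measure.ext_of_singleton fun k => ?_
  rw [withDensity_apply _ (measurableSet_singleton k), lintegral_singleton, Measure.smul_apply,
    Measure.map_apply hK (measurableSet_singleton k),
    Measure.map_apply .of_discrete (measurableSet_singleton k), Measure.map_apply hK .of_discrete]
  have h1 : (fun ω s => (Φ ω ∩ D s).encard) ⁻¹' {k} =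
      ⋂ s ∈ Finset.univ, (fun ω => (Φ ω ∩ D s).encard) ⁻¹' {k s} := by
    ext ω
    simp [funext_iff]
  have h2 : (fun ω s => (Φ ω ∩ D s).encard) ⁻¹' ((fun k => k + Pi.single t 1) ⁻¹' {k}) =
      ⋂ s ∈ Finset.univ, (fun ω => (Φ ω ∩ D s).encard) ⁻¹'
        (if s = t then {x | x + 1 = k s} else {k s}) := by
    ext ω
    simp only [mem_preimage, mem_singleton_iff, funext_iff, Pi.add_apply, Finset.mem_univ,
      iInter_true, mem_iInter]
    refine forall_congr' fun s => ?_
    split_ifs with h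
    · subst h; simp
    · simp [h]
  rw [h1, h2, hind.measure_inter_preimage_eq_mul Finset.univ (fun _ _ => .of_discrete),
    hind.measure_inter_preimage_eq_mul Finset.univ (fun _ _ => .of_discrete)]
  simp_rw [hlaw]
  rw [← Finset.mul_prod_erase _ _ (Finset.mem_univ t), ← Finset.mul_prod_erase _ _ (Finset.mem_univ t),
    ← mul_assoc, mul_poissonLaw_singleton ht, if_pos rfl, smul_eq_mul, mul_assoc]
  congr 2
  refine Finset.prod_congr rfl fun s hs => ?_
  rw [if_neg (Finset.ne_of_mem_erase hs)]

end Poisson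

/-! ### Laws of random measures -/

section RandomMeasure

variable {E : Type*} [MeasurableSpace E]

theorem measure_preimage_eq_sum {τ : Type*} [Fintype τ] [MeasurableSpace τ]
    [DiscreteMeasurableSpace τ] (m : Measure E) {π : E → τ} (hπ : Measurable π)
    (T : τ → Prop) [DecidablePred T] :
    m {p | T (π p)} = ∑ t, if T t then m (π ⁻¹' {t}) else 0 := by
  have h : {p | T (π p)} = π ⁻¹' {t | T t} := rfl
  rw [h, ← Measure.map_apply hπ .of_discrete, ← lintegral_indicator_one .of_discrete,
    lintegral_fintype]
  refine Finset.sum_congr rfl fun t _ => ?_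
  rw [Measure.map_apply hπ .of_discrete]
  by_cases ht : T t <;> simp [ht]

/-- The σ-algebra on `Measure E` is pulled back from a product by the evaluations, and a finite
measure on a product is determined by its finite-dimensional marginals. -/
theorem measure_measure_ext {ν₁ ν₂ : Measure (Measure E)} [IsFiniteMeasure ν₁] [IsFiniteMeasure ν₂]
    (h : ∀ J : Finset {C : Set E // MeasurableSet C},
      ν₁.map (fun m (j : J) => m (j : {C : Set E // MeasurableSet C}).1) =
        ν₂.map (fun m (j : J) => m (j : {C : Set E // MeasurableSet C}).1)) : ν₁ = ν₂ := by
  let ev : Measure E → ({C : Set E // MeasurableSet C} → ℝ≥0∞) := fun m C => m C.1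
  have hev : Measurable ev := measurable_pi_lambda _ fun C => Measure.measurable_coe C.2
  have hcomap : (inferInstance : MeasurableSpace (Measure E)) =
      MeasurableSpace.comap ev MeasurableSpace.pi := by
    refine le_antisymm ?_ hev.comap_le
    refine iSup₂_le fun C hC => ?_
    have h1 : (fun m : Measure E => m C) = (fun g => g ⟨C, hC⟩) ∘ ev := rfl
    rw [h1, ← MeasurableSpace.comap_comp]
    exact MeasurableSpace.comap_mono (measurable_pi_apply _).comap_le
  have hmap : ν₁.map ev = ν₂.map ev := by
    refine IsProjectiveLimit.unique (P := fun J => (ν₁.map ev).map J.restrict)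
      (fun J => rfl) fun J => ?_
    change _ = (ν₁.map ev).map J.restrict
    rw [Measure.map_map (Finset.measurable_restrict J) hev,
      Measure.map_map (Finset.measurable_restrict J) hev]
    exact (h J).symm
  ext A hA
  have hA' : MeasurableSet[MeasurableSpace.comap ev MeasurableSpace.pi] A := by
    rw [← hcomap]; exact hA
  obtain ⟨A', hA', rfl⟩ := hA'
  rw [← Measure.map_apply hev hA', hmap, Measure.map_apply hev hA']

end RandomMeasure

/-! ### The Mecke formula -/

section Mecke

variable {Ω E : Type*} [MeasurableSpace Ω] [MeasurableSpace E]
  {Φ : Ω → Set E} {Λ : Measure E} {P : Measure Ω}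

theorem IsPoissonPointProcess.measurable (hΦ : IsPoissonPointProcess Φ Λ P) :
    Measurable fun ω => pointMeasure (Φ ω) := measurable_pointMeasure hΦ.measurable_count

theorem measurable_pointMeasure_add_dirac (hΦ : IsPoissonPointProcess Φ Λ P) :
    Measurable fun x : E × Ω => pointMeasure (Φ x.2) + Measure.dirac x.1 :=
  (hΦ.measurable.comp measurable_snd).add (Measure.measurable_dirac.comp measurable_fst)

open Classical in
-- The sets `C j` and `B` generate a finite partition, and all the values are sums of cell counts.
-- An extra point at `p` raises the count of its own cell by one, so the claim is the sum of
-- `withDensity_count` over the cells inside `B`.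
theorem IsPoissonPointProcess.map_withDensity_marginal [IsProbabilityMeasure P]
    (hΦ : IsPoissonPointProcess Φ Λ P) {B : Set E} (hB : MeasurableSet B) (hΛB : Λ B ≠ ∞)
    {J : Type*} [Fintype J] {C : J → Set E} (hC : ∀ j, MeasurableSet (C j)) :
    (P.withDensity fun ω => pointMeasure (Φ ω) B).map (fun ω j => pointMeasure (Φ ω) (C j)) =
      ((Λ.restrict B).prod P).map
        (fun x j => (pointMeasure (Φ x.2) + Measure.dirac x.1) (C j)) := by
  -- The cell of `p` is its pattern of memberships.
  let π : E → (J → Bool) × Bool := fun p => (fun j => decide (p ∈ C j), decide (p ∈ B))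
  have hdec : ∀ A : Set E, MeasurableSet A → Measurable fun p => decide (p ∈ A) := fun A hA => by
    refine measurable_to_bool ?_
    convert hA using 1
    ext p; simp
  have hπ : Measurable π := (measurable_pi_lambda _ fun j => hdec _ (hC j)).prodMk (hdec _ hB)
  let D : (J → Bool) × Bool → Set E := fun t => π ⁻¹' {t}
  have hD : ∀ t, MeasurableSet (D t) := fun t => hπ (measurableSet_singleton t)
  have hd : Pairwise fun s t => Disjoint (D s) (D t) := fun s t hst => by
    refine Disjoint.preimage _ ?_
    simpa using hst
  have hCsum : ∀ (m : Measure E) j, m (C j) = ∑ t, if t.1 j = true then m (D t) else 0 :=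
    fun m j => by
      rw [← measure_preimage_eq_sum m hπ fun t => t.1 j = true]
      simp [π]
  have hBsum : ∀ m : Measure E, m B = ∑ t, if t.2 = true then m (D t) else 0 := fun m => by
    rw [← measure_preimage_eq_sum m hπ fun t => t.2 = true]
    simp [π]
  have hDB : ∀ t, t.2 = true → D t ⊆ B := fun t ht p hp => by
    have : (π p).2 = true := by rw [show π p = t from hp, ht]
    simpa [π] using this
  have hDB' : ∀ t, t.2 = false → D t ∩ B = ∅ := fun t ht => by
    ext p
    simp only [mem_inter_iff, mem_empty_iff_false, iff_false, not_and]
    intro hp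
    have : (π p).2 = false := by rw [show π p = t from hp, ht]
    simpa [π] using this
  let K : Ω → (J → Bool) × Bool → ℕ∞ := fun ω t => (Φ ω ∩ D t).encard
  have hK : Measurable K := measurable_pi_lambda _ fun t => hΦ.measurable_count _ (hD t)
  let G : ((J → Bool) × Bool → ℕ∞) → J → ℝ≥0∞ :=
    fun k j => ∑ t, if t.1 j = true then (k t : ℝ≥0∞) else 0
  have hGK : ∀ ω, (fun j => pointMeasure (Φ ω) (C j)) = G (K ω) := fun ω => by
    funext j
    rw [hCsum]
    simp_rw [pointMeasure_apply _ (hD _)]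
    rfl
  have hGK' : ∀ p ω, (fun j => (pointMeasure (Φ ω) + Measure.dirac p) (C j)) =
      G (K ω + Pi.single (π p) 1) := fun p ω => by
    funext j
    rw [hCsum]
    refine Finset.sum_congr rfl fun t _ => ?_
    congr 1
    rw [Measure.add_apply, pointMeasure_apply _ (hD _), Measure.dirac_apply' _ (hD _), Pi.add_apply]
    by_cases h : π p = t
    · have hp : p ∈ D t := h
      subst h
      simp [hp, K]
    · have hp : p ∉ D t := h
      simp [hp, K, Pi.single_eq_of_ne (Ne.symm h)]
  have hN : Measurable fun ω => pointMeasure (Φ ω) := hΦ.measurable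
  ext T hT
  have hm1 : Measurable fun ω j => pointMeasure (Φ ω) (C j) :=
    measurable_pi_lambda _ fun j => (Measure.measurable_coe (hC j)).comp hN
  have hm2 : Measurable fun (x : E × Ω) j => (pointMeasure (Φ x.2) + Measure.dirac x.1) (C j) :=
    measurable_pi_lambda _ fun j =>
      (Measure.measurable_coe (hC j)).comp (measurable_pointMeasure_add_dirac hΦ)
  rw [Measure.map_apply hm1 hT, Measure.map_apply hm2 hT, withDensity_apply _ (hm1 hT),
    Measure.prod_apply (hm2 hT)]
  -- The probability depends on the added point only through its cell, so the integral over `p`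
  -- becomes a finite sum.
  let R : (J → Bool) × Bool → ℝ≥0∞ := fun t => P (K ⁻¹' ((fun k => k + Pi.single t 1) ⁻¹' (G ⁻¹' T)))
  have hR : ∀ p, P (Prod.mk p ⁻¹' ((fun (x : E × Ω) j =>
      (pointMeasure (Φ x.2) + Measure.dirac x.1) (C j)) ⁻¹' T)) =
      R (π p) := fun p => by
    simp only [R]
    congr 1
    ext ω
    simp only [mem_preimage, hGK' p ω]
  simp_rw [hR]
  rw [← lintegral_map (f := R) .of_discrete hπ, lintegral_fintype R]
  simp_rw [hBsum]
  rw [lintegral_finsetSum _ fun t _ => by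
    split_ifs
    · exact (Measure.measurable_coe (hD _)).comp hN
    · exact measurable_const]
  refine Finset.sum_congr rfl fun t _ => ?_
  rw [Measure.map_apply hπ (measurableSet_singleton t), Measure.restrict_apply (hD t)]
  cases ht : t.2 with
  | false =>
    rw [show π ⁻¹' {t} ∩ B = ∅ from hDB' t ht]
    simp
  | true =>
    rw [show π ⁻¹' {t} ∩ B = D t from inter_eq_left.2 (hDB t ht)]
    have hfin : Λ (D t) ≠ ∞ := ((measure_mono (hDB t ht)).trans_lt hΛB.lt_top).ne
    have key := congrArg (fun m => m (G ⁻¹' T)) (hΦ.withDensity_count hD hd t hfin)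
    simp only [Measure.smul_apply, smul_eq_mul] at key
    rw [withDensity_apply _ .of_discrete, Measure.map_apply .of_discrete .of_discrete,
      Measure.map_apply hK .of_discrete, setLIntegral_map .of_discrete .of_discrete hK] at key
    simp_rw [pointMeasure_apply _ (hD _)]
    have hpre : (fun ω j => pointMeasure (Φ ω) (C j)) ⁻¹' T = K ⁻¹' (G ⁻¹' T) := by
      ext ω
      simp only [mem_preimage, hGK ω]
    rw [hpre, mul_comm]
    simp only [if_true]
    convert key using 8

/-- Comparing total masses in the marginal identity, with no test sets at all, gives the mean count.
-/
theorem IsPoissonPointProcess.lintegral_count [IsProbabilityMeasure P]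
    (hΦ : IsPoissonPointProcess Φ Λ P) {B : Set E} (hB : MeasurableSet B) (hΛB : Λ B ≠ ∞) :
    ∫⁻ ω, pointMeasure (Φ ω) B ∂P = Λ B := by
  have h := congrArg (fun m => m univ) (hΦ.map_withDensity_marginal hB hΛB (J := Empty)
    (C := fun _ => ∅) (fun _ => MeasurableSet.empty))
  have : IsFiniteMeasure (Λ.restrict B) := ⟨by simpa using hΛB.lt_top⟩
  have hu : ((Λ.restrict B).prod P) univ = Λ B := by
    rw [← univ_prod_univ, Measure.prod_prod]
    simp
  rw [← hu]
  simpa [Measure.map_apply (show Measurable fun (ω : Ω) (j : Empty) => pointMeasure (Φ ω) ∅ from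
    measurable_pi_lambda _ fun j => j.elim) MeasurableSet.univ,
    Measure.map_apply (show Measurable fun (x : E × Ω) (j : Empty) =>
      (pointMeasure (Φ x.2) + Measure.dirac x.1) ∅ from
    measurable_pi_lambda _ fun j => j.elim) MeasurableSet.univ] using h

theorem IsPoissonPointProcess.map_withDensity [IsProbabilityMeasure P]
    (hΦ : IsPoissonPointProcess Φ Λ P) {B : Set E} (hB : MeasurableSet B) (hΛB : Λ B ≠ ∞) :
    (P.withDensity fun ω => pointMeasure (Φ ω) B).map (fun ω => pointMeasure (Φ ω)) =
      ((Λ.restrict B).prod P).map (fun x => pointMeasure (Φ x.2) + Measure.dirac x.1) := by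
  have : IsFiniteMeasure (P.withDensity fun ω => pointMeasure (Φ ω) B) :=
    isFiniteMeasure_withDensity (by rw [hΦ.lintegral_count hB hΛB]; exact hΛB)
  have : IsFiniteMeasure (Λ.restrict B) := ⟨by simpa using hΛB.lt_top⟩
  refine measure_measure_ext fun J => ?_
  have hm : Measurable fun (m : Measure E) (j : J) =>
      m (j : {C : Set E // MeasurableSet C}).1 :=
    measurable_pi_lambda _ fun j => Measure.measurable_coe j.1.2
  rw [Measure.map_map hm hΦ.measurable, Measure.map_map hm (measurable_pointMeasure_add_dirac hΦ)]
  exact hΦ.map_withDensity_marginal hB hΛB fun j : J => j.1.2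

theorem IsPoissonPointProcess.ae_lt_top [IsProbabilityMeasure P]
    (hΦ : IsPoissonPointProcess Φ Λ P) {S : ℕ → Set E} (hS : ∀ n, MeasurableSet (S n))
    (hΛS : ∀ n, Λ (S n) ≠ ∞) : ∀ᵐ ω ∂P, ∀ n, pointMeasure (Φ ω) (S n) < ∞ := by
  refine ae_all_iff.2 fun n => ?_
  refine MeasureTheory.ae_lt_top ((Measure.measurable_coe (hS n)).comp hΦ.measurable) ?_
  rw [hΦ.lintegral_count (hS n) (hΛS n)]
  exact hΛS n

/-- The Mecke formula. -/
theorem IsPoissonPointProcess.mecke [IsProbabilityMeasure P] [SFinite Λ]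
    (hΦ : IsPoissonPointProcess Φ Λ P) {S : ℕ → Set E} (hS : ∀ n, MeasurableSet (S n))
    (hcov : ⋃ n, S n = univ) (hΛS : ∀ n, Λ (S n) ≠ ∞)
    {f : E × Measure E → ℝ≥0∞} (hf : Measurable f) :
    ∫⁻ ω, ∫⁻ p, f (p, pointMeasure (Φ ω)) ∂(pointMeasure (Φ ω)) ∂P =
      ∫⁻ p, ∫⁻ ω, f (p, pointMeasure (Φ ω) + Measure.dirac p) ∂P ∂Λ := by
  have hN : Measurable fun ω => pointMeasure (Φ ω) := hΦ.measurable
  have hsf := isSFiniteKernel_locallyFiniteKernel hS hcov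
  -- An s-finite kernel that agrees almost surely with the counting measure, so that the composition
  -- product can be formed.
  let κ : Kernel Ω E := (locallyFiniteKernel S hS).comap _ hN
  have hκ : ∀ᵐ ω ∂P, κ ω = pointMeasure (Φ ω) := by
    filter_upwards [hΦ.ae_lt_top hS hΛS] with ω hω
    exact locallyFiniteKernel_apply hS hω
  have hm1 : Measurable fun x : Ω × E => (x.2, pointMeasure (Φ x.1)) :=
    measurable_snd.prodMk (hN.comp measurable_fst)
  have hm2 : Measurable fun x : E × Ω => (x.1, pointMeasure (Φ x.2) + Measure.dirac x.1) :=
    measurable_fst.prodMk (measurable_pointMeasure_add_dirac hΦ)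
  have key : (P ⊗ₘ κ).map (fun x => (x.2, pointMeasure (Φ x.1))) =
      (Λ.prod P).map (fun x => (x.1, pointMeasure (Φ x.2) + Measure.dirac x.1)) := by
    have hrect : ∀ (B : Set E) (T : Set (Measure E)), MeasurableSet B → MeasurableSet T →
        Λ B ≠ ∞ → (P ⊗ₘ κ).map (fun x => (x.2, pointMeasure (Φ x.1))) (B ×ˢ T) =
        (Λ.prod P).map (fun x => (x.1, pointMeasure (Φ x.2) + Measure.dirac x.1)) (B ×ˢ T) := by
      intro B T hB hT hΛB
      have h := congrArg (fun m => m T) (hΦ.map_withDensity hB hΛB)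
      rw [Measure.map_apply hN hT, Measure.map_apply (measurable_pointMeasure_add_dirac hΦ) hT,
        withDensity_apply _ (hN hT), Measure.prod_apply (measurable_pointMeasure_add_dirac hΦ hT)]
        at h
      rw [Measure.map_apply hm1 (hB.prod hT), Measure.map_apply hm2 (hB.prod hT),
        Measure.compProd_apply (hm1 (hB.prod hT)), Measure.prod_apply (hm2 (hB.prod hT))]
      rw [← lintegral_indicator (hN hT), ← lintegral_indicator hB] at h
      convert h using 1
      · refine lintegral_congr_ae ?_
        filter_upwards [hκ] with ω hω
        rw [hω]
        by_cases h : pointMeasure (Φ ω) ∈ T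
        · rw [indicator_of_mem (by exact h)]
          congr 1
          ext p; simp [h]
        · rw [indicator_of_notMem (by exact h)]
          convert measure_empty (μ := pointMeasure (Φ ω))
          ext p; simp [h]
      · refine lintegral_congr fun p => ?_
        by_cases h : p ∈ B
        · rw [indicator_of_mem h]
          congr 1
          ext ω; simp [h]
        · rw [indicator_of_notMem h]
          convert measure_empty (μ := P)
          ext ω; simp [h]
    -- Rectangles determine a measure once it is finite, hence the localization to the sets `S n`.
    refine Measure.ext_of_iUnion_eq_univ (s := fun n => S n ×ˢ univ) (by
      rw [← iUnion_prod_const, hcov, univ_prod_univ]) fun n => ?_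
    have hfin : IsFiniteMeasure (((P ⊗ₘ κ).map
        (fun x => (x.2, pointMeasure (Φ x.1)))).restrict (S n ×ˢ univ)) := by
      refine ⟨?_⟩
      rw [Measure.restrict_apply_univ, hrect _ _ (hS n) .univ (hΛS n), Measure.map_apply hm2
        ((hS n).prod .univ)]
      have : (fun x : E × Ω => (x.1, pointMeasure (Φ x.2) + Measure.dirac x.1)) ⁻¹' (S n ×ˢ univ) =
        S n ×ˢ univ := by ext; simp
      rw [this, Measure.prod_prod]
      simpa using (hΛS n).lt_top
    refine Measure.ext_prod fun {B T} hB hT => ?_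
    rw [Measure.restrict_apply (hB.prod hT), Measure.restrict_apply (hB.prod hT), prod_inter_prod,
      inter_univ]
    exact hrect _ _ (hB.inter (hS n)) hT
      ((measure_mono inter_subset_right).trans_lt (hΛS n).lt_top).ne
  have h := congrArg (fun m => ∫⁻ x, f x ∂m) key
  rw [lintegral_map hf hm1, lintegral_map hf hm2, 
    Measure.lintegral_compProd (f := fun x => f (x.2, pointMeasure (Φ x.1))) (hf.comp hm1),
    lintegral_prod (fun x : E × Ω => f (x.1, pointMeasure (Φ x.2) + Measure.dirac x.1))
      (hf.comp hm2).aemeasurable] at h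
  rw [← h]
  refine lintegral_congr_ae ?_
  filter_upwards [hκ] with ω hω
  rw [hω]

/-- The Mecke formula for pairs of distinct points. -/
theorem IsPoissonPointProcess.mecke_pair [IsProbabilityMeasure P] [SFinite Λ]
    (hΦ : IsPoissonPointProcess Φ Λ P) {S : ℕ → Set E} (hS : ∀ n, MeasurableSet (S n))
    (hcov : ⋃ n, S n = univ) (hΛS : ∀ n, Λ (S n) ≠ ∞)
    {f : E × E × Measure E → ℝ≥0∞} (hf : Measurable f) (hdiag : ∀ p m, f (p, p, m) = 0) :
    ∫⁻ ω, ∫⁻ p, ∫⁻ q, f (p, q, pointMeasure (Φ ω)) ∂(pointMeasure (Φ ω)) ∂(pointMeasure (Φ ω)) ∂P =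
      ∫⁻ p, ∫⁻ q, ∫⁻ ω, f (p, q, pointMeasure (Φ ω) + Measure.dirac q + Measure.dirac p) ∂P ∂Λ
        ∂Λ := by
  have hsf := isSFiniteKernel_locallyFiniteKernel hS hcov
  let g : E × Measure E → ℝ≥0∞ := fun x => ∫⁻ q, f (x.1, q, x.2) ∂(locallyFiniteKernel S hS x.2)
  have hg : Measurable g := by
    have : Measurable fun x : (E × Measure E) × E => f (x.1.1, x.2, x.1.2) := by fun_prop
    exact this.lintegral_kernel_prod_right' (κ := (locallyFiniteKernel S hS).comap Prod.snd
      measurable_snd)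
  have hgood : ∀ᵐ ω ∂P, ∀ n, pointMeasure (Φ ω) (S n) < ∞ := hΦ.ae_lt_top hS hΛS
  have h1 : ∫⁻ ω, ∫⁻ p, ∫⁻ q, f (p, q, pointMeasure (Φ ω)) ∂(pointMeasure (Φ ω))
      ∂(pointMeasure (Φ ω)) ∂P = ∫⁻ ω, ∫⁻ p, g (p, pointMeasure (Φ ω)) ∂(pointMeasure (Φ ω)) ∂P := by
    refine lintegral_congr_ae ?_
    filter_upwards [hgood] with ω hω
    simp only [g, locallyFiniteKernel_apply hS hω]
  rw [h1, hΦ.mecke hS hcov hΛS hg]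
  refine lintegral_congr fun p => ?_
  -- With `p` fixed and already added, the one-point formula is used again for `q`.
  let f' : E × Measure E → ℝ≥0∞ := fun x => f (p, x.1, x.2 + Measure.dirac p)
  have hf' : Measurable f' := by
    have : Measurable fun x : E × Measure E => (p, x.1, x.2 + Measure.dirac p) :=
      measurable_const.prodMk (measurable_fst.prodMk (measurable_snd.add measurable_const))
    exact hf.comp this
  have h2 := hΦ.mecke hS hcov hΛS hf'
  rw [← h2]
  refine lintegral_congr_ae ?_
  filter_upwards [hgood] with ω hω
  have hfin : ∀ n, (pointMeasure (Φ ω) + Measure.dirac p) (S n) < ∞ := fun n => by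
    rw [Measure.add_apply]
    exact ENNReal.add_lt_top.2 ⟨hω n, measure_lt_top _ _⟩
  simp only [g, locallyFiniteKernel_apply hS hfin]
  -- The atom added at `p` contributes only the diagonal term.
  rw [lintegral_add_measure, lintegral_dirac' _ (by fun_prop), hdiag, add_zero]

end Mecke

/-! ### Deterministic geometry of the lower left hull -/

section Hull

/-- `S` lies in the strip `(0, ∞) × (0, h)` and has finitely many points in every bounded part
of it. -/
structure IsLocallyFiniteInStrip (S : Set (ℝ × ℝ)) (h : ℝ) : Prop where
  pos_fst : ∀ p ∈ S, 0 < p.1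
  pos_snd : ∀ p ∈ S, 0 < p.2
  snd_lt : ∀ p ∈ S, p.2 < h
  finite_le : ∀ c : ℝ, (S ∩ {p | p.1 ≤ c}).Finite

variable {S : Set (ℝ × ℝ)} {h : ℝ}

theorem IsLocallyFiniteInStrip.insert_point (hS : IsLocallyFiniteInStrip S h) {p : ℝ × ℝ}
    (h1 : 0 < p.1) (h2 : 0 < p.2) (h3 : p.2 < h) : IsLocallyFiniteInStrip (insert p S) h where
  pos_fst q hq := by rcases hq with rfl | hq; exacts [h1, hS.pos_fst q hq]
  pos_snd q hq := by rcases hq with rfl | hq; exacts [h2, hS.pos_snd q hq]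
  snd_lt q hq := by rcases hq with rfl | hq; exacts [h3, hS.snd_lt q hq]
  finite_le c := ((hS.finite_le c).insert p).subset (by
    rintro q ⟨rfl | hq, hc⟩
    · exact mem_insert _ _
    · exact mem_insert_of_mem _ ⟨hq, hc⟩)

theorem IsLocallyFiniteInStrip.finite_add_mul_le (hS : IsLocallyFiniteInStrip S h) {α : ℝ}
    (hα : 0 < α) (c : ℝ) : (S ∩ {p | p.1 + α * p.2 ≤ c}).Finite :=
  (hS.finite_le c).subset fun p hp => ⟨hp.1, by
    have h1 := mul_pos hα (hS.pos_snd p hp.1)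
    have h2 : p.1 + α * p.2 ≤ c := hp.2
    change p.1 ≤ c
    linarith⟩

/-- Only finitely many points take values in `(c, c + 1]`. The gap leaves room for tilting a
supporting line slightly. -/
theorem IsLocallyFiniteInStrip.exists_gap (hS : IsLocallyFiniteInStrip S h) {α : ℝ}
    (hα : 0 < α) (c : ℝ) : ∃ δ > 0, ∀ q ∈ S, c < q.1 + α * q.2 → c + δ ≤ q.1 + α * q.2 := by
  have hfin : ((S ∩ {p | p.1 + α * p.2 ≤ c + 1}) ∩ {p | c < p.1 + α * p.2}).Finite :=
    (hS.finite_add_mul_le hα (c + 1)).inter_of_left _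
  rcases ((S ∩ {p | p.1 + α * p.2 ≤ c + 1}) ∩ {p | c < p.1 + α * p.2}).eq_empty_or_nonempty with
    he | hne
  · refine ⟨1, one_pos, fun q hq hc => ?_⟩
    by_contra hlt
    have : q ∈ ((S ∩ {p | p.1 + α * p.2 ≤ c + 1}) ∩ {p | c < p.1 + α * p.2}) :=
      ⟨⟨hq, (not_le.1 hlt).le⟩, hc⟩
    rw [he] at this
    exact this
  · obtain ⟨m, hm, hmin⟩ := exists_min_image _ (fun p : ℝ × ℝ => p.1 + α * p.2) hfin hne
    have hm2 : c < m.1 + α * m.2 := hm.2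
    refine ⟨min 1 (m.1 + α * m.2 - c), lt_min one_pos (by linarith), fun q hq hc => ?_⟩
    by_cases hle : q.1 + α * q.2 ≤ c + 1
    · have := hmin q ⟨⟨hq, hle⟩, hc⟩
      linarith [min_le_right 1 (m.1 + α * m.2 - c)]
    · linarith [min_le_left 1 (m.1 + α * m.2 - c)]

/-- Increasing `α` a little breaks ties in favour of the lowest point, and the gap keeps all other
points behind. -/
theorem IsLocallyFiniteInStrip.mem_vertices_of_lowest (hS : IsLocallyFiniteInStrip S h)
    {v : ℝ × ℝ} (hv : v ∈ S) {α : ℝ} (hα : 0 < α)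
    (hmin : ∀ q ∈ S, v.1 + α * v.2 ≤ q.1 + α * q.2)
    (hlow : ∀ q ∈ S, q ≠ v → q.1 + α * q.2 = v.1 + α * v.2 → v.2 < q.2) :
    v ∈ lowerLeftVertices S := by
  obtain ⟨δ, hδ, hgap⟩ := hS.exists_gap hα (v.1 + α * v.2)
  have hv2 := hS.pos_snd v hv
  have hε : 0 < δ / (v.2 + 1) := by positivity
  have hεδ : δ / (v.2 + 1) * v.2 < δ := by
    rw [div_mul_eq_mul_div, div_lt_iff₀ (by linarith)]
    nlinarith
  refine ⟨hv, α + δ / (v.2 + 1), by linarith, fun q hq hqv => ?_⟩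
  rcases (hmin q hq).eq_or_lt with heq | hlt
  · have := mul_lt_mul_of_pos_left (hlow q hq hqv heq.symm) hε
    linarith
  · have h1 := hgap q hq hlt
    have := mul_pos hε (hS.pos_snd q hq)
    linarith

/-- Here `α` is decreased. This lowers the value of `q` by `ε * q.2`, which the height `h` of the
strip bounds uniformly. -/
theorem IsLocallyFiniteInStrip.mem_vertices_of_highest (hS : IsLocallyFiniteInStrip S h)
    {v : ℝ × ℝ} (hv : v ∈ S) {α : ℝ} (hα : 0 < α)
    (hmin : ∀ q ∈ S, v.1 + α * v.2 ≤ q.1 + α * q.2)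
    (hhigh : ∀ q ∈ S, q ≠ v → q.1 + α * q.2 = v.1 + α * v.2 → q.2 < v.2) :
    v ∈ lowerLeftVertices S := by
  obtain ⟨δ, hδ, hgap⟩ := hS.exists_gap hα (v.1 + α * v.2)
  have hh : 0 < h := (hS.pos_snd v hv).trans (hS.snd_lt v hv)
  obtain ⟨ε, hε, hεα, hεδ⟩ : ∃ ε, 0 < ε ∧ ε < α ∧ ε * h ≤ δ := by
    refine ⟨min (α / 2) (δ / h), lt_min (by linarith) (by positivity),
      (min_le_left _ _).trans_lt (by linarith), ?_⟩
    calc min (α / 2) (δ / h) * h ≤ δ / h * h := by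
          gcongr; exact min_le_right _ _
      _ = δ := by field_simp
  refine ⟨hv, α - ε, by linarith, fun q hq hqv => ?_⟩
  rcases (hmin q hq).eq_or_lt with heq | hlt
  · have := mul_lt_mul_of_pos_left (hhigh q hq hqv heq.symm) hε
    linarith
  · have h1 := hgap q hq hlt
    have h2 := mul_lt_mul_of_pos_left (hS.snd_lt q hq) hε
    have h3 := mul_pos hε (hS.pos_snd v hv)
    linarith

/-- Minimizing lexicographically, first `x + α y` and then the height, selects the lowest minimizer,
which is a vertex. -/
theorem IsLocallyFiniteInStrip.exists_vertex_le (hS : IsLocallyFiniteInStrip S h) {r : ℝ × ℝ}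
    (hr : r ∈ S) {α : ℝ} (hα : 0 < α) :
    ∃ v ∈ lowerLeftVertices S, v.1 + α * v.2 ≤ r.1 + α * r.2 := by
  obtain ⟨v, hv, hmin⟩ := exists_min_image _ (fun p : ℝ × ℝ => toLex (p.1 + α * p.2, p.2))
    (hS.finite_add_mul_le hα (r.1 + α * r.2)) ⟨r, hr, le_refl (r.1 + α * r.2)⟩
  have hvr : v.1 + α * v.2 ≤ r.1 + α * r.2 := hv.2
  have hle : ∀ q ∈ S, v.1 + α * v.2 ≤ q.1 + α * q.2 := fun q hq => by
    by_cases hqr : q.1 + α * q.2 ≤ r.1 + α * r.2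
    · have := hmin q ⟨hq, hqr⟩
      rw [Prod.Lex.toLex_le_toLex] at this
      rcases this with h1 | h1
      · exact h1.le
      · exact h1.1.le
    · linarith
  refine ⟨v, hS.mem_vertices_of_lowest hv.1 hα hle fun q hq hqv heq => ?_, hvr⟩
  have := hmin q ⟨hq, by change q.1 + α * q.2 ≤ r.1 + α * r.2; linarith⟩
  rw [Prod.Lex.toLex_le_toLex] at this
  rcases this with h1 | h1
  · exact absurd heq h1.ne'
  · refine lt_of_le_of_ne h1.2 fun h2 => hqv ?_
    refine Prod.ext ?_ h2.symm
    change v.2 = q.2 at h2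
    rw [h2] at heq
    linarith

theorem fst_lt_of_snd_lt {u v : ℝ × ℝ} (hu : u ∈ S) (hv : v ∈ lowerLeftVertices S)
    (huv : u.2 < v.2) : v.1 < u.1 := by
  obtain ⟨_, α, hα, hmin⟩ := hv
  have := hmin u hu (fun he => by rw [he] at huv; exact lt_irrefl _ huv)
  have := mul_lt_mul_of_pos_left huv hα
  linarith

theorem eq_of_snd_eq {u v : ℝ × ℝ} (hu : u ∈ lowerLeftVertices S) (hv : v ∈ lowerLeftVertices S)
    (huv : u.2 = v.2) : u = v := by
  by_contra hne
  obtain ⟨hu', α, hα, hmin⟩ := hu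
  obtain ⟨hv', β, hβ, hmin'⟩ := hv
  have h1 := hmin v hv' (Ne.symm hne)
  have h2 := hmin' u hu' hne
  rw [huv] at h1 h2
  linarith

/-- Vertices above `u` lie to its left. This makes the numbering by decreasing height meaningful. -/
theorem IsLocallyFiniteInStrip.finite_above (hS : IsLocallyFiniteInStrip S h) {u : ℝ × ℝ}
    (hu : u ∈ S) : {q | q ∈ lowerLeftVertices S ∧ u.2 < q.2}.Finite :=
  (hS.finite_le u.1).subset fun _ hq => ⟨hq.1.1, (fst_lt_of_snd_lt hu hq.1 hq.2).le⟩

theorem IsVertexAt.rank_lt {p q : ℝ × ℝ} {i j : ℕ} (hp : IsVertexAt S i p) (hq : IsVertexAt S j q)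
    (hpq : q.2 < p.2) : i < j := by
  have hsub : insert p {v | v ∈ lowerLeftVertices S ∧ p.2 < v.2} ⊆
      {v | v ∈ lowerLeftVertices S ∧ q.2 < v.2} := by
    rintro v (rfl | hv)
    · exact ⟨hp.1, hpq⟩
    · exact ⟨hv.1, hpq.trans hv.2⟩
  have h1 := encard_le_encard hsub
  rw [encard_insert_of_notMem (fun h' => lt_irrefl _ h'.2), hp.2, hq.2] at h1
  have h2 : ((i + 1 : ℕ) : ℕ∞) ≤ (j : ℕ∞) := by exact_mod_cast h1
  exact Nat.lt_of_succ_le (by exact_mod_cast h2)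

theorem IsVertexAt.eq {p q : ℝ × ℝ} {i : ℕ} (hp : IsVertexAt S i p) (hq : IsVertexAt S i q) :
    p = q := by
  rcases lt_trichotomy p.2 q.2 with hlt | heq | hlt
  · exact absurd (hq.rank_lt hp hlt) (lt_irrefl _)
  · exact eq_of_snd_eq hp.1 hq.1 heq
  · exact absurd (hp.rank_lt hq hlt) (lt_irrefl _)

theorem IsVertexAt.snd_lt_succ {p q : ℝ × ℝ} {i : ℕ} (hp : IsVertexAt S i p)
    (hq : IsVertexAt S (i + 1) q) : q.2 < p.2 := by
  rcases lt_trichotomy p.2 q.2 with hlt | heq | hlt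
  · have := hq.rank_lt hp hlt
    omega
  · have he := eq_of_snd_eq hp.1 hq.1 heq
    have h1 := hp.2
    rw [he, hq.2] at h1
    have h2 : i + 1 = i := by exact_mod_cast h1
    omega
  · exact hlt

theorem vertexHeight_eq {p : ℝ × ℝ} {i : ℕ} (hp : IsVertexAt S i p) : vertexHeight S i = p.2 := by
  have hex : ∃ p, IsVertexAt S i p := ⟨p, hp⟩
  rw [vertexHeight, dif_pos hex, hex.choose_spec.eq hp]

theorem IsLocallyFiniteInStrip.exists_isVertexAt_succ (hS : IsLocallyFiniteInStrip S h)
    {p v : ℝ × ℝ} {i : ℕ} (hp : IsVertexAt S i p) (hv : v ∈ lowerLeftVertices S)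
    (hvp : v.2 < p.2) : ∃ q, IsVertexAt S (i + 1) q := by
  have hfin : (insert v {q | q ∈ lowerLeftVertices S ∧ v.2 < q.2} ∩ {q | q.2 < p.2}).Finite :=
    ((hS.finite_above hv.1).insert v).inter_of_left _
  obtain ⟨q, hq, hmax⟩ := exists_max_image _ (fun q : ℝ × ℝ => q.2) hfin
    ⟨v, mem_insert _ _, hvp⟩
  have hqv : q ∈ lowerLeftVertices S := by
    rcases hq.1 with rfl | hq'
    · exact hv
    · exact hq'.1
  refine ⟨q, hqv, ?_⟩
  have hset : {u | u ∈ lowerLeftVertices S ∧ q.2 < u.2} =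
      insert p {u | u ∈ lowerLeftVertices S ∧ p.2 < u.2} := by
    ext u
    constructor
    · rintro ⟨hu, hqu⟩
      rcases lt_trichotomy u.2 p.2 with hlt | heq | hlt
      · have hvu : v.2 < u.2 := (hmax v ⟨mem_insert _ _, hvp⟩).trans_lt hqu
        exact absurd (hmax u ⟨mem_insert_of_mem _ ⟨hu, hvu⟩, hlt⟩) (not_le.2 hqu)
      · exact Or.inl (eq_of_snd_eq hu hp.1 heq)
      · exact Or.inr ⟨hu, hlt⟩
    · have hqp : q.2 < p.2 := hq.2
      rintro (rfl | hu)
      · exact ⟨hp.1, hqp⟩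
      · exact ⟨hu.1, hqp.trans hu.2⟩
  rw [hset, encard_insert_of_notMem (fun h' => lt_irrefl _ h'.2), hp.2]
  simp

theorem IsLocallyFiniteInStrip.exists_isVertexAt_zero (hS : IsLocallyFiniteInStrip S h)
    {v : ℝ × ℝ} (hv : v ∈ lowerLeftVertices S) : ∃ q, IsVertexAt S 0 q := by
  obtain ⟨q, hq, hmax⟩ := exists_max_image _ (fun q : ℝ × ℝ => q.2)
    ((hS.finite_above hv.1).insert v) ⟨v, mem_insert _ _⟩
  have hqv : q ∈ lowerLeftVertices S := by
    rcases hq with rfl | hq'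
    · exact hv
    · exact hq'.1
  refine ⟨q, hqv, ?_⟩
  rw [Nat.cast_zero, encard_eq_zero]
  refine eq_empty_of_forall_notMem fun u hu => ?_
  exact absurd (hmax u (mem_insert_of_mem _ ⟨hu.1, (hmax v (mem_insert _ _)).trans_lt hu.2⟩))
    (not_le.2 hu.2)

/-- For large `α` the lower point `r` beats `p`; a vertex at least as good as `r` in that direction
must then be below `p`, because `p` is optimal for the smaller value `β`. -/
theorem IsLocallyFiniteInStrip.exists_vertex_below (hS : IsLocallyFiniteInStrip S h)
    {p r : ℝ × ℝ} (hp : p ∈ lowerLeftVertices S) (hr : r ∈ S) (hrp : r.2 < p.2) :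
    ∃ v ∈ lowerLeftVertices S, v.2 < p.2 := by
  obtain ⟨hpS, β, hβ, hmin⟩ := hp
  obtain ⟨α, hαβ, hα⟩ : ∃ α, β < α ∧ r.1 + α * r.2 < p.1 + α * p.2 := by
    have hd : 0 < p.2 - r.2 := by linarith
    -- The quotient is the value of `α` at which `r` and `p` tie.
    refine ⟨max β ((r.1 - p.1) / (p.2 - r.2)) + 1, by linarith [le_max_left β ((r.1 - p.1) /
      (p.2 - r.2))], ?_⟩
    have h1 : (r.1 - p.1) / (p.2 - r.2) < max β ((r.1 - p.1) / (p.2 - r.2)) + 1 := by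
      linarith [le_max_right β ((r.1 - p.1) / (p.2 - r.2))]
    rw [div_lt_iff₀ hd] at h1
    linarith
  obtain ⟨v, hv, hle⟩ := hS.exists_vertex_le hr (hβ.trans hαβ)
  refine ⟨v, hv, ?_⟩
  have hvp : v ≠ p := by
    rintro rfl
    linarith
  have h1 := hmin v hv.1 hvp
  by_contra hge
  have := mul_le_mul_of_nonneg_left (not_lt.1 hge) (sub_pos.2 hαβ).le
  linarith

theorem IsLocallyFiniteInStrip.exists_isVertexAt (hS : IsLocallyFiniteInStrip S h)
    (hlow : ∀ ε > 0, ∃ p ∈ S, p.2 < ε) (i : ℕ) : ∃ p, IsVertexAt S i p := by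
  induction i with
  | zero =>
    obtain ⟨r, hr, -⟩ := hlow 1 one_pos
    obtain ⟨v, hv, -⟩ := hS.exists_vertex_le hr one_pos
    exact hS.exists_isVertexAt_zero hv
  | succ i ih =>
    obtain ⟨p, hp⟩ := ih
    obtain ⟨r, hr, hrp⟩ := hlow p.2 (hS.pos_snd p hp.1.1)
    obtain ⟨v, hv, hvp⟩ := hS.exists_vertex_below hp.1 hr hrp
    exact hS.exists_isVertexAt_succ hp hv hvp

/-- A vertex above `p` that lies above the line with normal vector `(1, α)` through `p` has a
supporting line which is steeper than that line. -/
theorem slope_lt {T : Set (ℝ × ℝ)} {p v : ℝ × ℝ} {α β : ℝ} (hpT : p ∈ T) (hvp : p.2 < v.2)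
    (hle : p.1 + α * p.2 ≤ v.1 + α * v.2)
    (hmin : ∀ q ∈ T, q ≠ v → v.1 + β * v.2 < q.1 + β * q.2) : β < α := by
  have h1 := hmin p hpT (fun he => by rw [he] at hvp; exact lt_irrefl _ hvp)
  by_contra hge
  have := mul_le_mul_of_nonneg_right (not_lt.1 hge) (sub_pos.2 hvp).le
  linarith

/-- A vertex above `p` is supported in a direction `β < α`, in which `q` comes after `p` and so
cannot interfere. Hence the rank of `p` does not depend on `q`, which the product form of the joint
law requires. -/
theorem vertices_above_insert {p q : ℝ × ℝ} {α : ℝ} (hqp : q.2 < p.2)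
    (hα : p.1 + α * p.2 = q.1 + α * q.2) (hbelow : ∀ r ∈ S, p.1 + α * p.2 < r.1 + α * r.2) :
    {v | v ∈ lowerLeftVertices (insert p (insert q S)) ∧ p.2 < v.2} =
      {v | v ∈ lowerLeftVertices (insert p S) ∧ p.2 < v.2} := by
  ext v
  constructor
  · rintro ⟨⟨hv, β, hβ, hmin⟩, hpv⟩
    refine ⟨⟨?_, β, hβ, fun r hr => hmin r ?_⟩, hpv⟩
    · rcases hv with rfl | rfl | hv
      · exact mem_insert _ _
      · exact absurd hpv (not_lt.2 hqp.le)
      · exact mem_insert_of_mem _ hv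
    · rcases hr with rfl | hr
      · exact mem_insert _ _
      · exact mem_insert_of_mem _ (mem_insert_of_mem _ hr)
  · rintro ⟨⟨hv, β, hβ, hmin⟩, hpv⟩
    have hvS : v ∈ S := by
      rcases hv with rfl | hv
      · exact absurd hpv (lt_irrefl _)
      · exact hv
    have hβα : β < α := slope_lt (mem_insert p S) hpv (hbelow v hvS).le hmin
    have h1 := hmin p (mem_insert _ _) (fun he => by rw [he] at hpv; exact lt_irrefl _ hpv)
    refine ⟨⟨mem_insert_of_mem _ (mem_insert_of_mem _ hvS), β, hβ, fun r hr hrv => ?_⟩, hpv⟩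
    rcases hr with rfl | rfl | hr
    · exact h1
    · have := mul_lt_mul_of_pos_right hβα (sub_pos.2 hqp)
      linarith
    · exact hmin r (mem_insert_of_mem _ hr) hrv

/-- The points `p` and `q` are consecutive vertices of `S ∪ {p, q}` if and only if there is no
point of `S` below the line through them. -/
theorem IsLocallyFiniteInStrip.isVertexAt_pair_iff {p q : ℝ × ℝ}
    (hT : IsLocallyFiniteInStrip (insert p (insert q S)) h) {α : ℝ} (hα0 : 0 < α)
    (hqp : q.2 < p.2) (hα : p.1 + α * p.2 = q.1 + α * q.2)
    (hline : ∀ r ∈ S, r.1 + α * r.2 ≠ p.1 + α * p.2) (i : ℕ) :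
    (IsVertexAt (insert p (insert q S)) i p ∧ IsVertexAt (insert p (insert q S)) (i + 1) q) ↔
      (∀ r ∈ S, p.1 + α * p.2 < r.1 + α * r.2) ∧
        {v | v ∈ lowerLeftVertices (insert p S) ∧ p.2 < v.2}.encard = i := by
  have hpT : p ∈ insert p (insert q S) := mem_insert _ _
  have hqT : q ∈ insert p (insert q S) := mem_insert_of_mem _ (mem_insert _ _)
  constructor
  · rintro ⟨hp, hq⟩
    have hbelow : ∀ r ∈ S, p.1 + α * p.2 < r.1 + α * r.2 := by
      -- A point below the line would produce a vertex strictly between `p` and `q` in height, so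
      -- the ranks would differ by at least two.
      by_contra! hcon
      obtain ⟨r, hr, hrle⟩ := hcon
      have hrlt := lt_of_le_of_ne hrle (hline r hr)
      obtain ⟨v, hv, hvr⟩ := hT.exists_vertex_le
        (mem_insert_of_mem p (mem_insert_of_mem q hr)) hα0
      obtain ⟨-, β, hβ, hminp⟩ := hp.1
      obtain ⟨-, γ, hγ, hminq⟩ := hq.1
      have hvp : v ≠ p := by rintro rfl; linarith
      have hvq : v ≠ q := by rintro rfl; linarith
      have hpq : q ≠ p := by rintro rfl; exact lt_irrefl _ hqp
      have h1 := hminp q hqT hpq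
      have h2 := hminp v hv.1 hvp
      have h3 := hminq p hpT (Ne.symm hpq)
      have h4 := hminq v hv.1 hvq
      have hβα : β < α := by
        by_contra hge
        have := mul_le_mul_of_nonneg_right (not_lt.1 hge) (sub_pos.2 hqp).le
        linarith
      have hγα : α < γ := by
        by_contra hge
        have := mul_le_mul_of_nonneg_right (not_lt.1 hge) (sub_pos.2 hqp).le
        linarith
      have hv1 : v.2 < p.2 := by
        by_contra hge
        have := mul_le_mul_of_nonneg_left (not_lt.1 hge) (sub_pos.2 hβα).le
        linarith
      have hv2 : q.2 < v.2 := by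
        by_contra hge
        have := mul_le_mul_of_nonneg_left (not_lt.1 hge) (sub_pos.2 hγα).le
        linarith
      have hsub : insert v (insert p {u | u ∈ lowerLeftVertices (insert p (insert q S)) ∧
          p.2 < u.2}) ⊆ {u | u ∈ lowerLeftVertices (insert p (insert q S)) ∧ q.2 < u.2} := by
        rintro u (rfl | rfl | hu)
        · exact ⟨hv, hv2⟩
        · exact ⟨hp.1, hqp⟩
        · exact ⟨hu.1, hqp.trans hu.2⟩
      have hc := encard_le_encard hsub
      rw [encard_insert_of_notMem, encard_insert_of_notMem (fun h' => lt_irrefl _ h'.2), hp.2,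
        hq.2] at hc
      · have hc' : i + 1 + 1 ≤ i + 1 := by exact_mod_cast hc
        omega
      · rintro (h' | h')
        · exact hvp h'
        · exact lt_asymm hv1 h'.2
    refine ⟨hbelow, ?_⟩
    rw [← vertices_above_insert hqp hα hbelow]
    exact hp.2
  · rintro ⟨hbelow, hcard⟩
    have hpv : p ∈ lowerLeftVertices (insert p (insert q S)) := by
      -- In the direction `α` the minimizers are exactly `p` and `q`, the highest and the lowest on
      -- their line.
      refine hT.mem_vertices_of_highest hpT hα0 ?_ ?_
      · rintro r (rfl | rfl | hr)
        exacts [le_rfl, hα.le, (hbelow r hr).le]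
      · rintro r (rfl | rfl | hr) hne he
        exacts [absurd rfl hne, hqp, absurd he (hline r hr)]
    have hqv : q ∈ lowerLeftVertices (insert p (insert q S)) := by
      refine hT.mem_vertices_of_lowest hqT hα0 ?_ ?_
      · rintro r (rfl | rfl | hr)
        exacts [hα.ge, le_rfl, hα ▸ (hbelow r hr).le]
      · rintro r (rfl | rfl | hr) hne he
        exacts [hqp, absurd rfl hne, absurd (he.trans hα.symm) (hline r hr)]
    have hp : IsVertexAt (insert p (insert q S)) i p :=
      ⟨hpv, by rw [vertices_above_insert hqp hα hbelow, hcard]⟩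
    refine ⟨hp, hqv, ?_⟩
    have hset : {u | u ∈ lowerLeftVertices (insert p (insert q S)) ∧ q.2 < u.2} =
        insert p {u | u ∈ lowerLeftVertices (insert p (insert q S)) ∧ p.2 < u.2} := by
      ext u
      constructor
      · rintro ⟨hu, hqu⟩
        rcases lt_trichotomy u.2 p.2 with hlt | heq | hlt
        -- A vertex between `p` and `q` in height would have to lie below the chord, where there is
        -- no point.
        · exfalso
          have huS : u ∈ S := by
            rcases hu.1 with rfl | rfl | hu
            exacts [absurd hlt (lt_irrefl _), absurd hqu (lt_irrefl _), hu]
          obtain ⟨-, β, hβ, hmin⟩ := hu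
          have h0 := hbelow u huS
          have h1 := hmin p hpT (by rintro rfl; exact lt_irrefl _ hlt)
          have h2 := hmin q hqT (by rintro rfl; exact lt_irrefl _ hqu)
          have h3 : α < β := by
            by_contra hge
            have := mul_le_mul_of_nonneg_right (not_lt.1 hge) (sub_pos.2 hlt).le
            linarith
          have h4 := mul_lt_mul_of_pos_right h3 (sub_pos.2 hqu)
          linarith
        · exact Or.inl (eq_of_snd_eq hu hpv heq)
        · exact Or.inr ⟨hu, hlt⟩
      · rintro (rfl | hu)
        · exact ⟨hpv, hqp⟩
        · exact ⟨hu.1, hqp.trans hu.2⟩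
    rw [hset, encard_insert_of_notMem (fun h' => lt_irrefl _ h'.2), hp.2]
    simp

end Hull

/-! ### Being vertex number `i` as a measurable condition on the counting measure -/

section VertexTest

/-- The half-planes `{p | p.1 ≤ n}`. -/
def leftHalfPlane (n : ℕ) : Set (ℝ × ℝ) := {p | p.1 ≤ n}

theorem measurableSet_leftHalfPlane (n : ℕ) : MeasurableSet (leftHalfPlane n) :=
  measurableSet_le measurable_fst measurable_const

theorem iUnion_leftHalfPlane : ⋃ n, leftHalfPlane n = univ :=
  eq_univ_of_forall fun p => mem_iUnion.2 (exists_nat_ge p.1)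

/-- The identity kernel on the measures that are finite on all left half-planes. -/
def planeKernel : Kernel (Measure (ℝ × ℝ)) (ℝ × ℝ) :=
  locallyFiniteKernel leftHalfPlane measurableSet_leftHalfPlane

instance : IsSFiniteKernel planeKernel :=
  isSFiniteKernel_locallyFiniteKernel measurableSet_leftHalfPlane iUnion_leftHalfPlane

theorem planeKernel_apply {m : Measure (ℝ × ℝ)} (hm : ∀ n, m (leftHalfPlane n) < ∞) :
    planeKernel m = m := locallyFiniteKernel_apply measurableSet_leftHalfPlane hm

theorem measurable_planeKernel_section {α : Type*} [MeasurableSpace α] {f : α → Measure (ℝ × ℝ)}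
    (hf : Measurable f) {t : Set (α × (ℝ × ℝ))} (ht : MeasurableSet t) :
    Measurable fun a => planeKernel (f a) (Prod.mk a ⁻¹' t) :=
  Kernel.measurable_kernel_prodMk_left (κ := planeKernel.comap f hf) ht

/-- Pairs `(p, m)` such that `p` is strictly below all other points of `m` in the direction
`(1, α)` for some rational `α > 0`. -/
def vertexTest : Set ((ℝ × ℝ) × Measure (ℝ × ℝ)) :=
  ⋃ α ∈ {α : ℚ | 0 < α}, {x | planeKernel x.2
    (Prod.mk x ⁻¹' {y : ((ℝ × ℝ) × Measure (ℝ × ℝ)) × (ℝ × ℝ) |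
      y.2 ≠ y.1.1 ∧ y.2.1 + α * y.2.2 ≤ y.1.1.1 + α * y.1.1.2}) = 0}

theorem measurableSet_vertexTest : MeasurableSet vertexTest := by
  refine MeasurableSet.biUnion (to_countable _) fun α _ => ?_
  refine (measurable_planeKernel_section measurable_snd ?_) (measurableSet_singleton 0)
  have h1 : MeasurableSet {y : ((ℝ × ℝ) × Measure (ℝ × ℝ)) × (ℝ × ℝ) | y.2 = y.1.1} :=
    measurableSet_eq_fun measurable_snd (measurable_fst.comp measurable_fst)
  have h2 : MeasurableSet {y : ((ℝ × ℝ) × Measure (ℝ × ℝ)) × (ℝ × ℝ) |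
      y.2.1 + α * y.2.2 ≤ y.1.1.1 + α * y.1.1.2} :=
    measurableSet_le (by fun_prop) (by fun_prop)
  exact h1.compl.inter h2

/-- The number of points of `m` above `p` that pass the vertex test. -/
def vertexRank (x : (ℝ × ℝ) × Measure (ℝ × ℝ)) : ℝ≥0∞ :=
  planeKernel x.2 (Prod.mk x ⁻¹' {y : ((ℝ × ℝ) × Measure (ℝ × ℝ)) × (ℝ × ℝ) |
    y.1.1.2 < y.2.2 ∧ (y.2, y.1.2) ∈ vertexTest})

theorem measurable_vertexRank : Measurable vertexRank := by
  refine measurable_planeKernel_section measurable_snd ?_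
  have h1 : MeasurableSet {y : ((ℝ × ℝ) × Measure (ℝ × ℝ)) × (ℝ × ℝ) | y.1.1.2 < y.2.2} :=
    measurableSet_lt (by fun_prop) (by fun_prop)
  exact h1.inter ((measurable_snd.prodMk (measurable_snd.comp measurable_fst)) measurableSet_vertexTest)

/-- Pairs `(p, m)` such that `p` passes the test for vertex number `i` of `m`. -/
def vertexAtTest (i : ℕ) : Set ((ℝ × ℝ) × Measure (ℝ × ℝ)) :=
  vertexTest ∩ {x | vertexRank x = i}

theorem measurableSet_vertexAtTest (i : ℕ) : MeasurableSet (vertexAtTest i) :=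
  measurableSet_vertexTest.inter (measurable_vertexRank (measurableSet_singleton _))

variable {T : Set (ℝ × ℝ)} {h : ℝ}

theorem pointMeasure_eq_zero_iff {E : Type*} [MeasurableSpace E] {T B : Set E}
    (hB : MeasurableSet B) : pointMeasure T B = 0 ↔ ∀ q ∈ T, q ∉ B := by
  rw [pointMeasure_apply _ hB, ENat.toENNReal_eq_zero, encard_eq_zero, eq_empty_iff_forall_notMem]
  simp only [mem_inter_iff, not_and]

theorem IsLocallyFiniteInStrip.pointMeasure_lt_top (hT : IsLocallyFiniteInStrip T h) (n : ℕ) :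
    pointMeasure T (leftHalfPlane n) < ∞ := by
  rw [pointMeasure_apply _ (measurableSet_leftHalfPlane n)]
  exact ENat.toENNReal_lt_top.2 (encard_lt_top_iff.2 (hT.finite_le n))

theorem IsLocallyFiniteInStrip.planeKernel_pointMeasure (hT : IsLocallyFiniteInStrip T h) :
    planeKernel (pointMeasure T) = pointMeasure T := planeKernel_apply hT.pointMeasure_lt_top

/-- Rational directions suffice: by the gap, a strict minimizer for `α` remains one for every `β`
slightly larger. -/
theorem IsLocallyFiniteInStrip.mem_vertexTest_iff (hT : IsLocallyFiniteInStrip T h) {p : ℝ × ℝ}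
    (hp : p ∈ T) : (p, pointMeasure T) ∈ vertexTest ↔ p ∈ lowerLeftVertices T := by
  have hmeas : ∀ α : ℚ, MeasurableSet
      {q : ℝ × ℝ | q ≠ p ∧ q.1 + α * q.2 ≤ p.1 + α * p.2} := fun α => by
    have h1 : MeasurableSet {q : ℝ × ℝ | q.1 + α * q.2 ≤ p.1 + α * p.2} :=
      measurableSet_le (by fun_prop) measurable_const
    exact (measurableSet_singleton p).compl.inter h1
  have hiff : (p, pointMeasure T) ∈ vertexTest ↔
      ∃ α : ℚ, 0 < α ∧ ∀ q ∈ T, q ≠ p → p.1 + α * p.2 < q.1 + α * q.2 := by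
    simp only [vertexTest, mem_iUnion, mem_ofPred_eq, exists_prop, preimage_ofPred_eq]
    refine exists_congr fun α => and_congr_right fun _ => ?_
    rw [hT.planeKernel_pointMeasure, pointMeasure_eq_zero_iff (hmeas α)]
    refine forall₂_congr fun q _ => ?_
    simp only [mem_ofPred_eq, not_and, not_le]
  rw [hiff]
  constructor
  · rintro ⟨α, hα, hmin⟩
    exact ⟨hp, α, by exact_mod_cast hα, hmin⟩
  · rintro ⟨-, α, hα, hmin⟩
    obtain ⟨δ, hδ, hgap⟩ := hT.exists_gap hα (p.1 + α * p.2)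
    have hp2 := hT.pos_snd p hp
    obtain ⟨β, hβ1, hβ2⟩ := exists_rat_btwn (show α < α + δ / p.2 by
      linarith [div_pos hδ hp2])
    refine ⟨β, by exact_mod_cast hα.trans hβ1, fun q hq hqp => ?_⟩
    have h1 := hgap q hq (hmin q hq hqp)
    have h2 := mul_lt_mul_of_pos_right hβ2 hp2
    rw [add_mul, div_mul_cancel₀ _ hp2.ne'] at h2
    have h3 := mul_lt_mul_of_pos_right hβ1 (hT.pos_snd q hq)
    linarith

theorem IsLocallyFiniteInStrip.vertexRank_eq (hT : IsLocallyFiniteInStrip T h) (p : ℝ × ℝ) :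
    vertexRank (p, pointMeasure T) =
      ({v | v ∈ lowerLeftVertices T ∧ p.2 < v.2}.encard : ℝ≥0∞) := by
  have hmeas : MeasurableSet {v : ℝ × ℝ | p.2 < v.2 ∧ (v, pointMeasure T) ∈ vertexTest} := by
    have h1 : MeasurableSet {v : ℝ × ℝ | p.2 < v.2} :=
      measurableSet_lt measurable_const measurable_snd
    have h2 : Measurable fun v : ℝ × ℝ => (v, pointMeasure T) :=
      measurable_id.prodMk measurable_const
    exact h1.inter (h2 measurableSet_vertexTest)
  simp only [vertexRank, preimage_ofPred_eq]
  rw [hT.planeKernel_pointMeasure, pointMeasure_apply _ hmeas]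
  congr 2
  ext v
  simp only [mem_inter_iff, mem_ofPred_eq]
  constructor
  · rintro ⟨hv, h1, h2⟩
    exact ⟨(hT.mem_vertexTest_iff hv).1 h2, h1⟩
  · rintro ⟨hv, h1⟩
    exact ⟨hv.1, h1, (hT.mem_vertexTest_iff hv.1).2 hv⟩

theorem IsLocallyFiniteInStrip.vertexRank_eq_natCast_iff (hT : IsLocallyFiniteInStrip T h)
    (p : ℝ × ℝ) (i : ℕ) : vertexRank (p, pointMeasure T) = i ↔
      {v | v ∈ lowerLeftVertices T ∧ p.2 < v.2}.encard = i := by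
  rw [hT.vertexRank_eq, ← ENat.toENNReal_coe, ENat.toENNReal_inj]

theorem IsLocallyFiniteInStrip.mem_vertexAtTest_iff (hT : IsLocallyFiniteInStrip T h) {p : ℝ × ℝ}
    (hp : p ∈ T) (i : ℕ) : (p, pointMeasure T) ∈ vertexAtTest i ↔ IsVertexAt T i p := by
  rw [vertexAtTest, mem_inter_iff, hT.mem_vertexTest_iff hp, IsVertexAt, mem_ofPred_eq,
    hT.vertexRank_eq_natCast_iff]

end VertexTest

/-! ### Consecutive vertices as a double sum over points -/

section StepTest

theorem measurable_xIntercept : Measurable fun x : (ℝ × ℝ) × (ℝ × ℝ) => xIntercept x.1 x.2 := by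
  unfold xIntercept
  fun_prop

/-- Triples `(p, q, m)` such that `p` and `q` pass the tests for the vertices number `i` and `i + 1`
of `m`, and the line through them meets the `x`-axis to the left of `w`. -/
def stepTest (w : EReal) (i : ℕ) : Set ((ℝ × ℝ) × (ℝ × ℝ) × Measure (ℝ × ℝ)) :=
  {x | (x.1, x.2.2) ∈ vertexAtTest i ∧ (x.2.1, x.2.2) ∈ vertexAtTest (i + 1) ∧
    x.2.1.2 < x.1.2 ∧ (xIntercept x.1 x.2.1 : EReal) < w}

theorem measurableSet_stepTest (w : EReal) (i : ℕ) : MeasurableSet (stepTest w i) := by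
  have h1 : Measurable fun x : (ℝ × ℝ) × (ℝ × ℝ) × Measure (ℝ × ℝ) => (x.1, x.2.2) := by fun_prop
  have h2 : Measurable fun x : (ℝ × ℝ) × (ℝ × ℝ) × Measure (ℝ × ℝ) => (x.2.1, x.2.2) := by fun_prop
  have h3 : MeasurableSet {x : (ℝ × ℝ) × (ℝ × ℝ) × Measure (ℝ × ℝ) | x.2.1.2 < x.1.2} :=
    measurableSet_lt (by fun_prop) (by fun_prop)
  have h4 : Measurable fun x : (ℝ × ℝ) × (ℝ × ℝ) × Measure (ℝ × ℝ) =>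
      (xIntercept x.1 x.2.1 : EReal) := by
    have : Measurable fun x : (ℝ × ℝ) × (ℝ × ℝ) × Measure (ℝ × ℝ) => (x.1, x.2.1) := by fun_prop
    exact measurable_coe_real_ereal.comp (measurable_xIntercept.comp this)
  exact (h1 (measurableSet_vertexAtTest i)).inter ((h2 (measurableSet_vertexAtTest (i + 1))).inter
    (h3.inter (h4 measurableSet_Iio)))

/-- The function `g` of the heights of `p` and `q`, on the triples that pass the step test. -/
def stepFun (w : EReal) (i : ℕ) (g : ℝ × ℝ → ℝ≥0∞) :
    (ℝ × ℝ) × (ℝ × ℝ) × Measure (ℝ × ℝ) → ℝ≥0∞ :=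
  (stepTest w i).indicator fun x => g (x.1.2, x.2.1.2)

theorem measurable_stepFun (w : EReal) (i : ℕ) {g : ℝ × ℝ → ℝ≥0∞} (hg : Measurable g) :
    Measurable (stepFun w i g) := by
  refine Measurable.indicator ?_ (measurableSet_stepTest w i)
  exact hg.comp (by fun_prop)

variable {T : Set (ℝ × ℝ)} {h : ℝ}

theorem IsLocallyFiniteInStrip.mem_stepTest_iff (hT : IsLocallyFiniteInStrip T h) {p q : ℝ × ℝ}
    (hp : p ∈ T) (hq : q ∈ T) (w : EReal) (i : ℕ) : (p, q, pointMeasure T) ∈ stepTest w i ↔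
      IsVertexAt T i p ∧ IsVertexAt T (i + 1) q ∧ (xIntercept p q : EReal) < w := by
  simp only [stepTest, mem_ofPred_eq, hT.mem_vertexAtTest_iff hp, hT.mem_vertexAtTest_iff hq]
  constructor
  · rintro ⟨h1, h2, -, h3⟩
    exact ⟨h1, h2, h3⟩
  · rintro ⟨h1, h2, h3⟩
    -- For a genuine point set the ranks imply the comparison of heights. It is part of `stepTest`
    -- so that the diagonal vanishes for every measure, as `mecke_pair` requires.
    exact ⟨h1, h2, h1.snd_lt_succ h2, h3⟩

open Classical in
-- A vertex is determined by its number, so at most one pair contributes to the double sum. In this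
-- form the Mecke formula applies to functions of the heights.
theorem IsLocallyFiniteInStrip.lintegral_stepFun (hT : IsLocallyFiniteInStrip T h) (w : EReal)
    (i : ℕ) {g : ℝ × ℝ → ℝ≥0∞} (hg : Measurable g) :
    ∫⁻ p, ∫⁻ q, stepFun w i g (p, q, pointMeasure T) ∂(pointMeasure T) ∂(pointMeasure T) =
      if HasStepWithin T w i then g (vertexHeight T i, vertexHeight T (i + 1)) else 0 := by
  have hsf : SFinite (pointMeasure T) := by
    rw [← hT.planeKernel_pointMeasure]
    infer_instance
  have hm : Measurable fun x : (ℝ × ℝ) × (ℝ × ℝ) => stepFun w i g (x.1, x.2, pointMeasure T) :=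
    (measurable_stepFun w i hg).comp
      (measurable_fst.prodMk (measurable_snd.prodMk measurable_const))
  rw [lintegral_pointMeasure _ hm.lintegral_prod_right']
  have hin : ∀ p : ℝ × ℝ, ∫⁻ q, stepFun w i g (p, q, pointMeasure T) ∂(pointMeasure T) =
      ∑' q : T, stepFun w i g (p, q, pointMeasure T) := fun p =>
    lintegral_pointMeasure _ (hm.comp measurable_prodMk_left)
  simp_rw [hin]
  split_ifs with hstep
  · obtain ⟨p, q, hp, hq, hw⟩ := hstep
    have hpT := hp.1.1
    have hqT := hq.1.1
    rw [tsum_eq_single ⟨p, hpT⟩, tsum_eq_single ⟨q, hqT⟩, stepFun, indicator_of_mem,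
      vertexHeight_eq hp, vertexHeight_eq hq]
    · exact (hT.mem_stepTest_iff hpT hqT w i).2 ⟨hp, hq, hw⟩
    · intro q' hq'
      refine indicator_of_notMem (fun hmem => hq' ?_) _
      have := (hT.mem_stepTest_iff hpT q'.2 w i).1 hmem
      exact Subtype.ext (this.2.1.eq hq)
    · intro p' hp'
      refine ENNReal.tsum_eq_zero.2 fun q' => indicator_of_notMem (fun hmem => hp' ?_) _
      have := (hT.mem_stepTest_iff p'.2 q'.2 w i).1 hmem
      exact Subtype.ext (this.1.eq hp)
  · refine ENNReal.tsum_eq_zero.2 fun p => ENNReal.tsum_eq_zero.2 fun q =>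
      indicator_of_notMem (fun hmem => hstep ?_) _
    obtain ⟨h1, h2, h3⟩ := (hT.mem_stepTest_iff p.2 q.2 w i).1 hmem
    exact ⟨p, q, h1, h2, h3⟩

theorem measurable_lintegral_stepFun (w : EReal) (i : ℕ) {g : ℝ × ℝ → ℝ≥0∞} (hg : Measurable g) :
    Measurable fun m => ∫⁻ p, ∫⁻ q, stepFun w i g (p, q, m) ∂(planeKernel m) ∂(planeKernel m) := by
  have h1 : Measurable fun x : (Measure (ℝ × ℝ) × (ℝ × ℝ)) × (ℝ × ℝ) =>
      stepFun w i g (x.1.2, x.2, x.1.1) := (measurable_stepFun w i hg).comp (by fun_prop)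
  have h2 : Measurable fun x : Measure (ℝ × ℝ) × (ℝ × ℝ) =>
      ∫⁻ q, stepFun w i g (x.2, q, x.1) ∂(planeKernel x.1) :=
    h1.lintegral_kernel_prod_right' (κ := planeKernel.comap Prod.fst measurable_fst)
  exact h2.lintegral_kernel_prod_right'

end StepTest

/-! ### The Poisson process in a strip -/

section Strip

/-- The intensity `c λ × ν` on the strip `{0 < x < w}`. -/
def stripIntensity (c : ℝ≥0∞) (w : EReal) (ν : Measure ℝ) : Measure (ℝ × ℝ) :=
  c • ((volume.restrict {x : ℝ | 0 < x ∧ (x : EReal) < w}).prod ν)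

theorem measurableSet_abscissae (w : EReal) : MeasurableSet {x : ℝ | 0 < x ∧ (x : EReal) < w} :=
  measurableSet_Ioi.inter (measurable_coe_real_ereal measurableSet_Iio)

variable {Ω : Type*} [MeasurableSpace Ω] {P : Measure Ω} [IsProbabilityMeasure P]
  {Φ : Ω → Set (ℝ × ℝ)} {c : ℝ≥0∞} {ν : Measure ℝ} [IsFiniteMeasure ν] {h : ℝ} {w : EReal}

instance : SFinite (stripIntensity c w ν) := by
  unfold stripIntensity
  infer_instance

theorem stripIntensity_leftHalfPlane (hc : c ≠ ∞) (n : ℕ) :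
    stripIntensity c w ν (leftHalfPlane n) ≠ ∞ := by
  have hset : leftHalfPlane n = Iic (n : ℝ) ×ˢ univ := by
    ext p; simp [leftHalfPlane]
  rw [stripIntensity, Measure.smul_apply, hset, Measure.prod_prod, smul_eq_mul,
    Measure.restrict_apply measurableSet_Iic]
  refine ENNReal.mul_ne_top hc (ENNReal.mul_ne_top ?_ (measure_ne_top _ _))
  refine ((measure_mono ?_).trans_lt (measure_Ioc_lt_top (a := (0 : ℝ)) (b := n))).ne
  exact fun x hx => ⟨hx.2.1, hx.1⟩

theorem measurableSet_line (α b : ℝ) : MeasurableSet {r : ℝ × ℝ | r.1 + α * r.2 = b} :=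
  measurableSet_eq_fun (by fun_prop) measurable_const

/-- Horizontal sections of the line are single points, null for Lebesgue measure; so almost surely
no point of the process lies on a given line and ties do not arise. -/
theorem stripIntensity_line (α b : ℝ) :
    stripIntensity c w ν {r : ℝ × ℝ | r.1 + α * r.2 = b} = 0 := by
  rw [stripIntensity, Measure.smul_apply, Measure.prod_apply_symm (measurableSet_line α b)]
  have : ∀ y : ℝ, (fun x => (x, y)) ⁻¹' {r : ℝ × ℝ | r.1 + α * r.2 = b} = {b - α * y} := fun y => by
    ext x
    simp only [mem_preimage, mem_ofPred_eq, mem_singleton_iff]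
    constructor <;> intro h' <;> linarith
  simp [this]

theorem ae_forall_notMem_line
    (hΦ : IsPoissonPointProcess Φ (stripIntensity c w ν) P) (α b : ℝ) : ∀ᵐ ω ∂P, ∀ r ∈ Φ ω, r.1 + α * r.2 ≠ b := by
  have h1 := hΦ.lintegral_count (measurableSet_line α b)
    (by rw [stripIntensity_line]; exact ENNReal.zero_ne_top)
  have hm : Measurable fun ω => pointMeasure (Φ ω) {r : ℝ × ℝ | r.1 + α * r.2 = b} :=
    (Measure.measurable_coe (measurableSet_line α b)).comp hΦ.measurable
  rw [stripIntensity_line, lintegral_eq_zero_iff hm] at h1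
  filter_upwards [h1] with ω hω
  exact (pointMeasure_eq_zero_iff (measurableSet_line α b)).1 hω

theorem ae_isLocallyFiniteInStrip
    (hΦ : IsPoissonPointProcess Φ (stripIntensity c w ν) P)
    (hsub : ∀ ω, Φ ω ⊆ window w h) (hc : c ≠ ∞) : ∀ᵐ ω ∂P, IsLocallyFiniteInStrip (Φ ω) h := by
  filter_upwards [hΦ.ae_lt_top measurableSet_leftHalfPlane (stripIntensity_leftHalfPlane hc)] with
    ω hω
  refine ⟨fun p hp => (hsub ω hp).1, fun p hp => (hsub ω hp).2.2.1, fun p hp => (hsub ω hp).2.2.2,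
    fun b => ?_⟩
  obtain ⟨n, hn⟩ := exists_nat_ge b
  have h1 := hω n
  rw [pointMeasure_apply _ (measurableSet_leftHalfPlane n), ENat.toENNReal_lt_top,
    encard_lt_top_iff] at h1
  exact h1.subset fun p hp => ⟨hp.1, le_trans hp.2 hn⟩

/-- The set of `ω` with no point on or below the line with normal vector `(1, α)` through `p`
and exactly `i` vertices above `p`. -/
def emptyBelow {Ω : Type*} (Φ : Ω → Set (ℝ × ℝ)) (i : ℕ) : Set (((ℝ × ℝ) × ℝ) × Ω) :=
  {x | planeKernel (pointMeasure (Φ x.2)) (Prod.mk x ⁻¹' {y : (((ℝ × ℝ) × ℝ) × Ω) × (ℝ × ℝ) |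
      y.2.1 + y.1.1.2 * y.2.2 ≤ y.1.1.1.1 + y.1.1.2 * y.1.1.1.2}) = 0 ∧
    vertexRank (x.1.1, pointMeasure (Φ x.2) + Measure.dirac x.1.1) = i}

theorem measurableSet_emptyBelow {Ω : Type*} [MeasurableSpace Ω] {Φ : Ω → Set (ℝ × ℝ)}
    {Λ : Measure (ℝ × ℝ)} {P : Measure Ω} (hΦ : IsPoissonPointProcess Φ Λ P) (i : ℕ) : MeasurableSet (emptyBelow Φ i) := by
  have h1 : MeasurableSet {y : (((ℝ × ℝ) × ℝ) × Ω) × (ℝ × ℝ) |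
      y.2.1 + y.1.1.2 * y.2.2 ≤ y.1.1.1.1 + y.1.1.2 * y.1.1.1.2} :=
    measurableSet_le (by fun_prop) (by fun_prop)
  have h2 : Measurable fun x : ((ℝ × ℝ) × ℝ) × Ω => pointMeasure (Φ x.2) :=
    hΦ.measurable.comp measurable_snd
  have h3 : Measurable fun x : ((ℝ × ℝ) × ℝ) × Ω =>
      (x.1.1, pointMeasure (Φ x.2) + Measure.dirac x.1.1) :=
    (by fun_prop : Measurable fun x : ((ℝ × ℝ) × ℝ) × Ω => x.1.1).prodMk
      (h2.add (Measure.measurable_dirac.comp (by fun_prop)))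
  exact ((measurable_planeKernel_section h2 h1) (measurableSet_singleton 0)).inter
    ((measurable_vertexRank.comp h3) (measurableSet_singleton _))

theorem mem_emptyBelow_iff {Ω : Type*} {Φ : Ω → Set (ℝ × ℝ)} {ω : Ω} (hω : IsLocallyFiniteInStrip (Φ ω) h) {p : ℝ × ℝ}
    (hp1 : 0 < p.1) (hp2 : 0 < p.2) (hp3 : p.2 < h) (hp : p ∉ Φ ω) (α : ℝ) (i : ℕ) :
    ((p, α), ω) ∈ emptyBelow Φ i ↔ (∀ r ∈ Φ ω, p.1 + α * p.2 < r.1 + α * r.2) ∧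
        {v | v ∈ lowerLeftVertices (insert p (Φ ω)) ∧ p.2 < v.2}.encard = i := by
  have hm : MeasurableSet {r : ℝ × ℝ | r.1 + α * r.2 ≤ p.1 + α * p.2} :=
    measurableSet_le (by fun_prop) measurable_const
  simp only [emptyBelow, mem_ofPred_eq, preimage_ofPred_eq]
  rw [hω.planeKernel_pointMeasure, pointMeasure_eq_zero_iff hm, ← pointMeasure_insert hp,
    (hω.insert_point hp1 hp2 hp3).vertexRank_eq_natCast_iff]
  refine and_congr_left fun _ => forall₂_congr fun q _ => ?_
  simp only [mem_ofPred_eq, not_le]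

/-- On the right, `emptyBelow` involves `q` only through the inverse slope of the edge; this is the
separation behind the whole result. -/
theorem ae_mem_stepTest_iff
    (hΦ : IsPoissonPointProcess Φ (stripIntensity c w ν) P)
    (hsub : ∀ ω, Φ ω ⊆ window w h) (hc : c ≠ ∞) {p q : ℝ × ℝ} (hp : p ∈ window w h) (hq : q ∈ window w h)
    (hqp : q.2 < p.2) (i : ℕ) : ∀ᵐ ω ∂P,
      ((p, q, pointMeasure (Φ ω) + Measure.dirac q + Measure.dirac p) ∈ stepTest w i ↔
        (p.1 < q.1 ∧ (xIntercept p q : EReal) < w) ∧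
          ((p, (q.1 - p.1) / (p.2 - q.2)), ω) ∈ emptyBelow Φ i) := by
  set α := (q.1 - p.1) / (p.2 - q.2) with hα
  have hd : 0 < p.2 - q.2 := sub_pos.2 hqp
  have hαeq : p.1 + α * p.2 = q.1 + α * q.2 := by
    have : α * (p.2 - q.2) = q.1 - p.1 := by rw [hα, div_mul_cancel₀ _ hd.ne']
    linarith
  filter_upwards [ae_isLocallyFiniteInStrip hΦ hsub hc,
    ae_forall_notMem_line hΦ α (p.1 + α * p.2)] with ω hω hline
  have hpΦ : p ∉ Φ ω := fun h' => hline p h' rfl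
  have hqΦ : q ∉ Φ ω := fun h' => hline q h' hαeq.symm
  have hpq : p ≠ q := by rintro rfl; exact lt_irrefl _ hqp
  have hT : IsLocallyFiniteInStrip (insert p (insert q (Φ ω))) h :=
    (hω.insert_point hq.1 hq.2.2.1 hq.2.2.2).insert_point hp.1 hp.2.2.1 hp.2.2.2
  have hpT : p ∈ insert p (insert q (Φ ω)) := mem_insert _ _
  have hqT : q ∈ insert p (insert q (Φ ω)) := mem_insert_of_mem _ (mem_insert _ _)
  rw [← pointMeasure_insert hqΦ, ← pointMeasure_insert (by
    rintro (h' | h')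
    exacts [hpq h', hpΦ h']), hT.mem_stepTest_iff hpT hqT,
    mem_emptyBelow_iff hω hp.1 hp.2.2.1 hp.2.2.2 hpΦ]
  by_cases hlt : p.1 < q.1
  · have hα0 : 0 < α := div_pos (sub_pos.2 hlt) hd
    rw [← hT.isVertexAt_pair_iff hα0 hqp hαeq hline]
    tauto
  -- Without `p.1 < q.1` the edge has no positive inverse slope, and the lower vertex always lies to
  -- the right.
  · refine iff_of_false (fun h' => hlt ?_) fun h' => hlt h'.1.1
    exact fst_lt_of_snd_lt hqT h'.1.1 hqp

end Strip

/-! ### Joint law of consecutive heights -/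

section StepFormula

/-- The substitution `x = b + d α`; its Jacobian with `d = s - y` is the source of the density `s -
y`. -/
theorem lintegral_eq_ofReal_mul_lintegral_comp {F : ℝ → ℝ≥0∞} (hF : Measurable F) (b : ℝ) {d : ℝ}
    (hd : 0 < d) : ∫⁻ x, F x = ENNReal.ofReal d * ∫⁻ α, F (b + d * α) := by
  rw [← lintegral_add_left_eq_self F b]
  conv_lhs => rw [← Real.smul_map_volume_mul_left hd.ne']
  rw [lintegral_smul_measure, lintegral_map (f := fun x => F (b + x))
    (hF.comp (measurable_const_add b)) (measurable_const_mul d), abs_of_pos hd]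
  rfl

variable {Ω : Type*} [MeasurableSpace Ω] {P : Measure Ω} [IsProbabilityMeasure P]
  {Φ : Ω → Set (ℝ × ℝ)} {c : ℝ≥0∞} {ν : Measure ℝ} [IsFiniteMeasure ν] {h : ℝ} {w : EReal}

/-- The density at inverse slope `α` of the next edge of the hull out of the `i`-th vertex `p`. -/
def edgeDensity (Φ : Ω → Set (ℝ × ℝ)) (P : Measure Ω) (w : EReal) (i : ℕ) :
    (ℝ × ℝ) × ℝ → ℝ≥0∞ :=
  {x | 0 < x.2 ∧ ((x.1.1 + x.1.2 * x.2 : ℝ) : EReal) < w}.indicator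
    fun x => P (Prod.mk x ⁻¹' emptyBelow Φ i)

theorem measurable_edgeDensity {Λ : Measure (ℝ × ℝ)} (hΦ : IsPoissonPointProcess Φ Λ P) (i : ℕ) :
    Measurable (edgeDensity Φ P w i) := by
  have h1 : MeasurableSet {x : (ℝ × ℝ) × ℝ | 0 < x.2} :=
    measurableSet_lt measurable_const measurable_snd
  have h2 : Measurable fun x : (ℝ × ℝ) × ℝ => ((x.1.1 + x.1.2 * x.2 : ℝ) : EReal) :=
    measurable_coe_real_ereal.comp (by fun_prop)
  exact (measurable_measure_prodMk_left (measurableSet_emptyBelow hΦ i)).indicator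
    (h1.inter (h2 measurableSet_Iio))

theorem lintegral_stepFun_add_dirac (hΦ : IsPoissonPointProcess Φ (stripIntensity c w ν) P)
    (hsub : ∀ ω, Φ ω ⊆ window w h) (hc : c ≠ ∞) {p q : ℝ × ℝ} (hp : p ∈ window w h)
    (hq : q ∈ window w h) (i : ℕ) (g : ℝ × ℝ → ℝ≥0∞) :
    ∫⁻ ω, stepFun w i g (p, q, pointMeasure (Φ ω) + Measure.dirac q + Measure.dirac p) ∂P =
      if q.2 < p.2 then g (p.2, q.2) * edgeDensity Φ P w i (p, (q.1 - p.1) / (p.2 - q.2)) else 0 := by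
  split_ifs with hqp
  · have hd : 0 < p.2 - q.2 := sub_pos.2 hqp
    have hiff : ((0 < (q.1 - p.1) / (p.2 - q.2)) ∧
        ((p.1 + p.2 * ((q.1 - p.1) / (p.2 - q.2)) : ℝ) : EReal) < w) ↔
        (p.1 < q.1 ∧ (xIntercept p q : EReal) < w) := by
      rw [xIntercept, mul_div_assoc, div_pos_iff_of_pos_right hd, sub_pos]
    have hmeas : MeasurableSet (Prod.mk (p, (q.1 - p.1) / (p.2 - q.2)) ⁻¹' emptyBelow Φ i) :=
      measurable_prodMk_left (measurableSet_emptyBelow hΦ i)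
    have hae : ∀ᵐ ω ∂P,
        stepFun w i g (p, q, pointMeasure (Φ ω) + Measure.dirac q + Measure.dirac p) =
        (Prod.mk (p, (q.1 - p.1) / (p.2 - q.2)) ⁻¹' emptyBelow Φ i).indicator (fun _ =>
          if p.1 < q.1 ∧ (xIntercept p q : EReal) < w then g (p.2, q.2) else 0) ω := by
      filter_upwards [ae_mem_stepTest_iff hΦ hsub hc hp hq hqp i] with ω hω
      by_cases hmem : (p, q, pointMeasure (Φ ω) + Measure.dirac q + Measure.dirac p) ∈ stepTest w i
      · rw [stepFun, indicator_of_mem hmem, indicator_of_mem (by exact (hω.1 hmem).2),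
          if_pos (hω.1 hmem).1]
      · rw [stepFun, indicator_of_notMem hmem]
        by_cases hE : ω ∈ Prod.mk (p, (q.1 - p.1) / (p.2 - q.2)) ⁻¹' emptyBelow Φ i
        · rw [indicator_of_mem hE, if_neg fun h1 => hmem (hω.2 ⟨h1, hE⟩)]
        · rw [indicator_of_notMem hE]
    rw [lintegral_congr_ae hae, lintegral_indicator_const hmeas, edgeDensity]
    by_cases h1 : p.1 < q.1 ∧ (xIntercept p q : EReal) < w
    · rw [if_pos h1, indicator_of_mem (by exact hiff.2 h1)]
    · rw [if_neg h1, indicator_of_notMem (by exact fun h' => h1 (hiff.1 h')), zero_mul, mul_zero]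
  · rw [← lintegral_zero (μ := P)]
    refine lintegral_congr fun ω => indicator_of_notMem (fun hmem => hqp hmem.2.2.1) _

theorem ae_stripIntensity_mem_window {c : ℝ≥0∞} {ν : Measure ℝ} {h : ℝ} {w : EReal} [SFinite ν]
    (hν : ν (Ioo 0 h)ᶜ = 0) :
    ∀ᵐ p ∂(stripIntensity c w ν), p ∈ window w h := by
  refine Measure.ae_smul_measure ?_ c
  have h1 : ∀ᵐ x : ℝ ∂(volume.restrict {x : ℝ | 0 < x ∧ (x : EReal) < w}), 0 < x ∧ (x : EReal) < w :=
    ae_restrict_mem (measurableSet_abscissae w)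
  have h2 : ∀ᵐ y ∂ν, y ∈ Ioo 0 h := hν
  filter_upwards [Measure.quasiMeasurePreserving_fst.ae h1,
    Measure.quasiMeasurePreserving_snd.ae h2] with p hp1 hp2
  exact ⟨hp1.1, hp1.2, hp2.1, hp2.2⟩

/-- For each height `y`, passing from `x` to the inverse slope costs the factor `p.2 - y` and leaves
an integral over `α` free of `y`, so the two integrations separate. -/
theorem lintegral_stripIntensity_edgeDensity
    (hΦ : IsPoissonPointProcess Φ (stripIntensity c w ν) P) (hν : ν (Ioo 0 h)ᶜ = 0)
    {p : ℝ × ℝ} (hp : p ∈ window w h) (i : ℕ) {g : ℝ × ℝ → ℝ≥0∞} (hg : Measurable g) :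
    ∫⁻ q, (if q.2 < p.2 then
      g (p.2, q.2) * edgeDensity Φ P w i (p, (q.1 - p.1) / (p.2 - q.2)) else 0)
        ∂(stripIntensity c w ν) =
      (c * ∫⁻ α, edgeDensity Φ P w i (p, α)) *
        ∫⁻ y, ENNReal.ofReal (p.2 - y) * g (p.2, y) ∂ν := by
  have hm : Measurable fun q : ℝ × ℝ => if q.2 < p.2 then
      g (p.2, q.2) * edgeDensity Φ P w i (p, (q.1 - p.1) / (p.2 - q.2)) else 0 := by
    refine Measurable.ite (measurableSet_lt measurable_snd measurable_const) ?_ measurable_const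
    refine (hg.comp (by fun_prop)).mul ((measurable_edgeDensity hΦ i).comp (by fun_prop))
  rw [stripIntensity, lintegral_smul_measure, lintegral_prod_symm' _ hm, smul_eq_mul, mul_assoc]
  congr 1
  have hgm : Measurable fun y => ENNReal.ofReal (p.2 - y) * g (p.2, y) := by fun_prop
  rw [← lintegral_const_mul _ hgm]
  have h2 : ∀ᵐ y ∂ν, y ∈ Ioo 0 h := hν
  refine lintegral_congr_ae ?_
  filter_upwards [h2] with y hy
  by_cases hyp : y < p.2
  · have hd : 0 < p.2 - y := sub_pos.2 hyp
    simp only [hyp, if_true]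
    have hFm : Measurable fun x : ℝ =>
        g (p.2, y) * edgeDensity Φ P w i (p, (x - p.1) / (p.2 - y)) :=
      measurable_const.mul ((measurable_edgeDensity hΦ i).comp (by fun_prop))
    -- The constraint `x < w` can be dropped: since `0 < y`, the line meets the axis at or beyond
    -- `x`, and `edgeDensity` already asks that this happen before `w`.
    have hrestr : ∫⁻ x in {x : ℝ | 0 < x ∧ (x : EReal) < w},
        g (p.2, y) * edgeDensity Φ P w i (p, (x - p.1) / (p.2 - y)) =
        ∫⁻ x, g (p.2, y) * edgeDensity Φ P w i (p, (x - p.1) / (p.2 - y)) := by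
      refine setLIntegral_eq_of_support_subset ?_
      intro x hx
      have hx' : edgeDensity Φ P w i (p, (x - p.1) / (p.2 - y)) ≠ 0 := fun h0 => hx (by
        simp only [h0, mul_zero])
      have hmem := mem_of_indicator_ne_zero hx'
      obtain ⟨h1, h3⟩ := hmem
      change 0 < (x - p.1) / (p.2 - y) at h1
      rw [div_pos_iff_of_pos_right hd, sub_pos] at h1
      refine ⟨hp.1.trans h1, lt_of_le_of_lt ?_ h3⟩
      rw [EReal.coe_le_coe_iff]
      change x ≤ p.1 + p.2 * ((x - p.1) / (p.2 - y))
      have h4 : x - p.1 ≤ p.2 * ((x - p.1) / (p.2 - y)) := by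
        rw [← mul_div_assoc, le_div_iff₀ hd]
        nlinarith [hy.1]
      linarith
    rw [hrestr, lintegral_eq_ofReal_mul_lintegral_comp hFm p.1 hd]
    have hsimp : ∀ α, (p.1 + (p.2 - y) * α - p.1) / (p.2 - y) = α := fun α => by
      rw [add_sub_cancel_left, mul_div_cancel_left₀ _ hd.ne']
    simp_rw [hsimp]
    have hem : Measurable fun α => edgeDensity Φ P w i (p, α) :=
      (measurable_edgeDensity hΦ i).comp measurable_prodMk_left
    rw [lintegral_const_mul _ hem,
      ← mul_assoc, mul_comm]
  · simp only [hyp, if_false, lintegral_zero]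
    rw [ENNReal.ofReal_of_nonpos (by linarith), zero_mul, mul_zero]

open Classical in
/-- The joint law of two consecutive heights, on the event of a step within the window, in product
form: given the vertex `p`, the next height has a density proportional to `p.2 - y`. -/
theorem lintegral_step_eq (hΦ : IsPoissonPointProcess Φ (stripIntensity c w ν) P)
    (hsub : ∀ ω, Φ ω ⊆ window w h) (hc : c ≠ ∞) (hν : ν (Ioo 0 h)ᶜ = 0) (i : ℕ)
    {g : ℝ × ℝ → ℝ≥0∞} (hg : Measurable g) :
    ∫⁻ ω, (if HasStepWithin (Φ ω) w i then
      g (vertexHeight (Φ ω) i, vertexHeight (Φ ω) (i + 1)) else 0) ∂P =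
      ∫⁻ p, (c * ∫⁻ α, edgeDensity Φ P w i (p, α)) *
        ∫⁻ y, ENNReal.ofReal (p.2 - y) * g (p.2, y) ∂ν ∂(stripIntensity c w ν) := by
  have hdiag : ∀ p m, stepFun w i g (p, p, m) = 0 := fun p m =>
    indicator_of_notMem (fun hmem => lt_irrefl _ hmem.2.2.1) _
  have h1 := hΦ.mecke_pair measurableSet_leftHalfPlane iUnion_leftHalfPlane
    (stripIntensity_leftHalfPlane hc) (measurable_stepFun w i hg) hdiag
  have h2 : ∀ᵐ ω ∂P, (if HasStepWithin (Φ ω) w i then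
      g (vertexHeight (Φ ω) i, vertexHeight (Φ ω) (i + 1)) else 0) =
      ∫⁻ p, ∫⁻ q, stepFun w i g (p, q, pointMeasure (Φ ω)) ∂(pointMeasure (Φ ω))
        ∂(pointMeasure (Φ ω)) := by
    filter_upwards [ae_isLocallyFiniteInStrip hΦ hsub hc] with ω hω
    rw [hω.lintegral_stepFun w i hg]
  rw [lintegral_congr_ae h2, h1]
  refine lintegral_congr_ae ?_
  filter_upwards [ae_stripIntensity_mem_window hν] with p hp
  rw [← lintegral_stripIntensity_edgeDensity hΦ hν hp i hg]
  refine lintegral_congr_ae ?_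
  filter_upwards [ae_stripIntensity_mem_window hν] with q hq
  exact lintegral_stepFun_add_dirac hΦ hsub hc hp hq i g

open Classical in
theorem aemeasurable_step (hΦ : IsPoissonPointProcess Φ (stripIntensity c w ν) P)
    (hsub : ∀ ω, Φ ω ⊆ window w h) (hc : c ≠ ∞) (i : ℕ)
    {g : ℝ × ℝ → ℝ≥0∞} (hg : Measurable g) :
    AEMeasurable (fun ω => if HasStepWithin (Φ ω) w i then
      g (vertexHeight (Φ ω) i, vertexHeight (Φ ω) (i + 1)) else 0) P := by
  refine ⟨_, (measurable_lintegral_stepFun w i hg).comp hΦ.measurable, ?_⟩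
  filter_upwards [ae_isLocallyFiniteInStrip hΦ hsub hc] with ω hω
  rw [Function.comp_apply, hω.planeKernel_pointMeasure, hω.lintegral_stepFun w i hg]

end StepFormula

/-! ### The law with density proportional to `s - y`, and its cdf -/

section StepLaw

variable (G : Measure ℝ)

/-- The law of `y / s` when `y` has density `s - y` with respect to `G` on `[0, s]`, before
normalization. -/
def stepMeasure (s : ℝ) : Measure ℝ :=
  ((G.restrict (Icc 0 s)).withDensity fun y => ENNReal.ofReal (s - y)).map fun y => y / s

theorem lintegral_stepMeasure (s : ℝ) {f : ℝ → ℝ≥0∞} (hf : Measurable f) :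
    ∫⁻ b, f b ∂(stepMeasure G s) = ∫⁻ y in Icc 0 s, ENNReal.ofReal (s - y) * f (y / s) ∂G := by
  have hd : Measurable fun y : ℝ => y / s := by fun_prop
  rw [stepMeasure, lintegral_map hf hd, lintegral_withDensity_eq_lintegral_mul _ (by fun_prop)
    (show Measurable fun y => f (y / s) from hf.comp hd)]
  rfl

theorem stepMeasure_apply (s : ℝ) {B : Set ℝ} (hB : MeasurableSet B) :
    stepMeasure G s B =
      ∫⁻ y in Icc 0 s, ENNReal.ofReal (s - y) * B.indicator 1 (y / s) ∂G := by
  rw [← lintegral_stepMeasure G s (measurable_one.indicator hB), lintegral_indicator_one hB]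

theorem measurable_stepMeasure [SFinite G] : Measurable (stepMeasure G) := by
  refine Measure.measurable_of_measurable_coe _ fun B hB => ?_
  simp_rw [stepMeasure_apply G _ hB, ← lintegral_indicator measurableSet_Icc]
  have h1 : MeasurableSet {x : ℝ × ℝ | 0 ≤ x.2 ∧ x.2 ≤ x.1} :=
    (measurableSet_le measurable_const measurable_snd).inter
      (measurableSet_le measurable_snd measurable_fst)
  have h2 : Measurable fun x : ℝ × ℝ =>
      ENNReal.ofReal (x.1 - x.2) * B.indicator (1 : ℝ → ℝ≥0∞) (x.2 / x.1) := by
    have : Measurable (B.indicator (1 : ℝ → ℝ≥0∞)) := measurable_one.indicator hB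
    fun_prop
  exact (h2.indicator h1).lintegral_prod_right'

open Classical in
/-- The law of `y / s` when `y` has density proportional to `s - y` with respect to `G` on
`[0, s]`. -/
def stepLaw (s : ℝ) : Measure ℝ :=
  if stepMeasure G s univ ≠ 0 ∧ stepMeasure G s univ ≠ ∞ then
    (stepMeasure G s univ)⁻¹ • stepMeasure G s else Measure.dirac 0

/-- The default `dirac 0` makes this hold for every `s`, as a Markov kernel on `ℝ` needs. -/
instance isProbabilityMeasure_stepLaw (s : ℝ) : IsProbabilityMeasure (stepLaw G s) := by
  unfold stepLaw
  split_ifs with hs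
  · refine ⟨?_⟩
    rw [Measure.smul_apply, smul_eq_mul, ENNReal.inv_mul_cancel hs.1 hs.2]
  · infer_instance

theorem stepLaw_apply {s : ℝ} (h0 : stepMeasure G s univ ≠ 0) (h1 : stepMeasure G s univ ≠ ∞)
    (B : Set ℝ) : stepLaw G s B = (stepMeasure G s univ)⁻¹ * stepMeasure G s B := by
  rw [stepLaw, if_pos ⟨h0, h1⟩, Measure.smul_apply, smul_eq_mul]

theorem measurable_stepLaw [SFinite G] : Measurable (stepLaw G) := by
  classical
  have hm : Measurable fun s => stepMeasure G s univ :=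
    (Measure.measurable_coe .univ).comp (measurable_stepMeasure G)
  refine Measurable.ite ((hm (measurableSet_singleton 0)).compl.inter
    (hm (measurableSet_singleton ∞)).compl) ?_ measurable_const
  refine Measure.measurable_of_measurable_coe _ fun B hB => ?_
  simp only [Measure.smul_apply, smul_eq_mul]
  exact hm.inv.mul ((Measure.measurable_coe hB).comp (measurable_stepMeasure G))

/-- The laws `stepLaw G s` as a Markov kernel. -/
def stepKernel [SFinite G] : Kernel ℝ ℝ := ⟨stepLaw G, measurable_stepLaw G⟩

instance [SFinite G] : IsMarkovKernel (stepKernel G) := ⟨isProbabilityMeasure_stepLaw G⟩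

/-- The numerator of `stepCDF`, with values in `[0, ∞]`. -/
def stepNumerator (s b : ℝ) : ℝ≥0∞ :=
  ENNReal.ofReal (1 - b) * G (Icc 0 (s * b)) + ∫⁻ t in Ioc 0 b, G (Icc 0 (s * t))

/-- Tonelli's theorem on the region `0 ≤ y ≤ s t`, `0 < t ≤ b`. -/
theorem lintegral_measure_Icc [SFinite G] {s : ℝ} (hs : 0 < s) (b : ℝ) :
    ∫⁻ t in Ioc 0 b, G (Icc 0 (s * t)) =
      ∫⁻ y in Icc 0 (s * b), ENNReal.ofReal (b - y / s) ∂G := by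
  have hset : MeasurableSet {x : ℝ × ℝ | 0 ≤ x.2 ∧ x.2 ≤ s * x.1} := by
    have h1 : MeasurableSet {x : ℝ × ℝ | x.2 ≤ s * x.1} :=
      measurableSet_le measurable_snd (by fun_prop)
    exact (measurableSet_le measurable_const measurable_snd).inter h1
  have hl : ∫⁻ t in Ioc 0 b, G (Icc 0 (s * t)) =
      ((volume.restrict (Ioc 0 b)).prod G) {x : ℝ × ℝ | 0 ≤ x.2 ∧ x.2 ≤ s * x.1} := by
    rw [Measure.prod_apply hset]
    rfl
  rw [hl, Measure.prod_apply_symm hset, ← lintegral_indicator measurableSet_Icc]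
  refine lintegral_congr fun y => ?_
  rw [Measure.restrict_apply (measurable_prodMk_right hset)]
  by_cases hy : y ∈ Icc 0 (s * b)
  · rw [indicator_of_mem hy, ← Real.volume_Icc]
    -- At `y = 0` the section is `(0, b]` instead of `[y / s, b]`, with the same length.
    rcases hy.1.eq_or_lt with h0 | h0
    · have : (fun x => (x, y)) ⁻¹' {x : ℝ × ℝ | 0 ≤ x.2 ∧ x.2 ≤ s * x.1} ∩ Ioc 0 b = Ioc 0 b := by
        refine inter_eq_right.2 fun t ht => ⟨hy.1, ?_⟩
        change y ≤ s * t
        rw [← h0]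
        exact (mul_pos hs ht.1).le
      rw [this, ← h0, zero_div, Real.volume_Icc, Real.volume_Ioc]
    · congr 1
      ext t
      simp only [mem_inter_iff, mem_preimage, mem_ofPred_eq, mem_Ioc, mem_Icc, div_le_iff₀ hs]
      constructor
      · rintro ⟨⟨-, h1⟩, -, h2⟩
        exact ⟨by linarith, h2⟩
      · rintro ⟨h1, h2⟩
        refine ⟨⟨hy.1, by linarith⟩, ?_, h2⟩
        exact pos_of_mul_pos_left (h0.trans_le h1) hs.le
  · rw [indicator_of_notMem hy]
    convert measure_empty (μ := (volume : Measure ℝ))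
    refine eq_empty_of_forall_notMem fun t ht => hy ⟨ht.1.1, ?_⟩
    exact ht.1.2.trans (mul_le_mul_of_nonneg_left ht.2.2 hs.le)

/-- On `y ≤ s b` the density splits as `s - y = s * ((1 - b) + (b - y / s))` into nonnegative terms;
they give the two terms of the numerator. -/
theorem stepMeasure_Iic [SFinite G] {s b : ℝ} (hs : 0 < s) (hb : b ≤ 1) :
    stepMeasure G s (Iic b) = ENNReal.ofReal s * stepNumerator G s b := by
  rw [stepMeasure_apply G s measurableSet_Iic, stepNumerator, lintegral_measure_Icc G hs]
  have hm : Measurable fun y : ℝ => ENNReal.ofReal (b - y / s) := by fun_prop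
  rw [← setLIntegral_const, ← lintegral_add_right _ hm, ← lintegral_const_mul _ (by fun_prop),
    ← lintegral_indicator measurableSet_Icc, ← lintegral_indicator measurableSet_Icc]
  refine lintegral_congr fun y => ?_
  by_cases hy : y ∈ Icc 0 (s * b)
  · have hyb : y / s ≤ b := by
      rw [div_le_iff₀ hs]; linarith [hy.2]
    have hys : y ∈ Icc 0 s := ⟨hy.1, hy.2.trans (mul_le_of_le_one_right hs.le hb)⟩
    rw [indicator_of_mem hy, indicator_of_mem hys, indicator_of_mem (by exact hyb), Pi.one_apply,
      mul_one, ← ENNReal.ofReal_add (by linarith) (by linarith), ← ENNReal.ofReal_mul hs.le]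
    congr 1
    field_simp
    ring
  · rw [indicator_of_notMem hy]
    by_cases hys : y ∈ Icc 0 s
    · rw [indicator_of_mem hys, indicator_of_notMem, mul_zero]
      intro hyb
      refine hy ⟨hys.1, ?_⟩
      have : y / s ≤ b := hyb
      rw [div_le_iff₀ hs] at this
      linarith
    · rw [indicator_of_notMem hys]

theorem stepMeasure_Icc [SFinite G] {s : ℝ} (hs : 0 < s) :
    stepMeasure G s (Icc 0 1) = stepMeasure G s univ := by
  rw [stepMeasure_apply G s measurableSet_Icc, stepMeasure_apply G s .univ]
  refine setLIntegral_congr_fun measurableSet_Icc fun y hy => ?_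
  have : y / s ∈ Icc (0 : ℝ) 1 := ⟨div_nonneg hy.1 hs.le, (div_le_one hs).2 hy.2⟩
  simp [this]

theorem stepMeasure_univ [SFinite G] {s : ℝ} (hs : 0 < s) :
    stepMeasure G s univ = ENNReal.ofReal s * stepNumerator G s 1 := by
  rw [← stepMeasure_Iic G hs le_rfl]
  refine le_antisymm ?_ (measure_mono (subset_univ _))
  rw [← stepMeasure_Icc G hs]
  exact measure_mono fun x hx => hx.2

theorem stepNumerator_ne_top {s b : ℝ} (hs : 0 < s) (hG : G (Icc 0 s) ≠ ∞)
    (hb : b ≤ 1) : stepNumerator G s b ≠ ∞ := by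
  have hle : ∀ t ≤ b, G (Icc 0 (s * t)) ≤ G (Icc 0 s) := fun t ht =>
    measure_mono (Icc_subset_Icc_right (mul_le_of_le_one_right hs.le (ht.trans hb)))
  refine ENNReal.add_ne_top.2 ⟨ENNReal.mul_ne_top ENNReal.ofReal_ne_top
    ((hle b le_rfl).trans_lt hG.lt_top).ne, ?_⟩
  refine ne_of_lt (lt_of_le_of_lt (setLIntegral_mono measurable_const fun t ht => hle t ht.2) ?_)
  rw [setLIntegral_const, Real.volume_Ioc]
  exact ENNReal.mul_lt_top hG.lt_top ENNReal.ofReal_lt_top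

theorem measurable_measure_Icc (s : ℝ) (hs : 0 < s) : Measurable fun t => G (Icc 0 (s * t)) :=
  Monotone.measurable fun _ _ hab =>
    measure_mono (Icc_subset_Icc_right (mul_le_mul_of_nonneg_left hab hs.le))

theorem stepNumerator_one_ne_zero {s : ℝ} (hs : 0 < s) (hpos : ∀ x > 0, 0 < G (Icc 0 x)) :
    stepNumerator G s 1 ≠ 0 := by
  rw [stepNumerator, sub_self, ENNReal.ofReal_zero, zero_mul, zero_add, ← pos_iff_ne_zero,
    setLIntegral_pos_iff (measurable_measure_Icc G s hs)]
  have : (Function.support fun t => G (Icc 0 (s * t))) ∩ Ioc 0 1 = Ioc 0 1 :=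
    inter_eq_right.2 fun t ht => (hpos _ (mul_pos hs ht.1)).ne'
  rw [this, Real.volume_Ioc]
  simp

theorem toReal_stepNumerator {s b : ℝ} (hs : 0 < s) (hG : G (Icc 0 s) ≠ ∞) (hb0 : 0 ≤ b)
    (hb : b ≤ 1) : (stepNumerator G s b).toReal =
      (1 - b) * G.real (Icc 0 (s * b)) + ∫ t in (0 : ℝ)..b, G.real (Icc 0 (s * t)) := by
  have hle : ∀ t ≤ b, G (Icc 0 (s * t)) < ∞ := fun t ht =>
    (measure_mono (Icc_subset_Icc_right
      (mul_le_of_le_one_right hs.le (ht.trans hb)))).trans_lt hG.lt_top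
  have htop := ENNReal.add_ne_top.1 (stepNumerator_ne_top G hs hG hb)
  rw [stepNumerator, ENNReal.toReal_add htop.1 htop.2, ENNReal.toReal_mul,
    ENNReal.toReal_ofReal (by linarith), intervalIntegral.integral_of_le hb0]
  congr 1
  symm
  refine integral_toReal (measurable_measure_Icc G s hs).aemeasurable ?_
  exact (ae_restrict_iff' measurableSet_Ioc).2 (ae_of_all _ fun t ht => hle t ht.2)

theorem stepMeasure_univ_ne [SFinite G] {s : ℝ} (hs : 0 < s) (hG : G (Icc 0 s) ≠ ∞)
    (hpos : ∀ x > 0, 0 < G (Icc 0 x)) :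
    stepMeasure G s univ ≠ 0 ∧ stepMeasure G s univ ≠ ∞ := by
  rw [stepMeasure_univ G hs]
  refine ⟨mul_ne_zero ?_ (stepNumerator_one_ne_zero G hs hpos),
    ENNReal.mul_ne_top ENNReal.ofReal_ne_top (stepNumerator_ne_top G hs hG le_rfl)⟩
  exact (ENNReal.ofReal_pos.2 hs).ne'

theorem stepLaw_Icc [SFinite G] {s : ℝ} (hs : 0 < s) (hG : G (Icc 0 s) ≠ ∞)
    (hpos : ∀ x > 0, 0 < G (Icc 0 x)) : stepLaw G s (Icc 0 1) = 1 := by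
  obtain ⟨h0, h1⟩ := stepMeasure_univ_ne G hs hG hpos
  rw [stepLaw_apply G h0 h1, stepMeasure_Icc G hs, ENNReal.inv_mul_cancel h0 h1]

theorem cdf_stepLaw [SFinite G] {s b : ℝ} (hs : 0 < s) (hG : G (Icc 0 s) ≠ ∞)
    (hpos : ∀ x > 0, 0 < G (Icc 0 x)) (hb0 : 0 ≤ b) (hb : b ≤ 1) :
    cdf (stepLaw G s) b = stepCDF G s b := by
  obtain ⟨h0, h1⟩ := stepMeasure_univ_ne G hs hG hpos
  have hden : (stepNumerator G s 1).toReal = ∫ t in (0 : ℝ)..1, G.real (Icc 0 (s * t)) := by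
    rw [toReal_stepNumerator G hs hG zero_le_one le_rfl]
    simp
  rw [cdf_eq_real, measureReal_def, stepLaw_apply G h0 h1, stepMeasure_univ G hs,
    stepMeasure_Iic G hs hb, stepCDF, ← toReal_stepNumerator G hs hG hb0 hb, ← hden,
    ENNReal.toReal_mul, ENNReal.toReal_inv, ENNReal.toReal_mul, ENNReal.toReal_mul,
    ENNReal.toReal_ofReal hs.le]
  rw [← div_eq_inv_mul, mul_div_mul_left _ _ hs.ne']

end StepLaw

/-! ### Behaviour of `G` near zero and the limit of the cdf -/

section Hazard

variable (μ : Measure ℝ)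

instance : SFinite (hazardMeasure μ) := by
  unfold hazardMeasure
  infer_instance

theorem hazardMeasure_Icc_ne_top (h0 : cdf μ 0 = 0) {x : ℝ} (hx : cdf μ x < 1) :
    hazardMeasure μ (Icc 0 x) ≠ ∞ := by
  rw [hazardMeasure_Icc μ x h0, if_pos hx]
  exact ENNReal.ofReal_ne_top

theorem hazardMeasure_singleton_zero (h0 : cdf μ 0 = 0) : hazardMeasure μ {0} = 0 := by
  rw [← Icc_self, hazardMeasure_Icc μ 0 h0, h0]
  simp

theorem hazardMeasure_Icc_pos (h0 : cdf μ 0 = 0) {x : ℝ} (hx : 0 < cdf μ x) :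
    0 < hazardMeasure μ (Icc 0 x) := by
  rw [hazardMeasure_Icc μ x h0]
  split_ifs with h1
  · rw [ENNReal.ofReal_pos, neg_pos]
    exact Real.log_neg (by linarith) (by linarith)
  · exact ENNReal.zero_lt_top

/-- The equivalence forces nonzero values arbitrarily close to `0`, and monotonicity carries
positivity to the right. -/
theorem cdf_pos_of_isEquivalent {a C : ℝ} (hC : 0 < C)
    (hF : (fun y => cdf μ y) ~[𝓝[>] 0] (fun y : ℝ => C * y ^ a)) {x : ℝ} (hx : 0 < x) :
    0 < cdf μ x := by
  have h1 : ∀ᶠ y : ℝ in 𝓝[>] 0, 0 < C * y ^ a := by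
    filter_upwards [self_mem_nhdsWithin] with y hy
    exact mul_pos hC (Real.rpow_pos_of_pos hy a)
  have h2 : ∀ᶠ y in 𝓝[>] 0, cdf μ y ≠ 0 := by
    filter_upwards [hF.symm.isBigO.eq_zero_imp, h1] with y hy1 hy2 h0
    exact hy2.ne' (hy1 h0)
  obtain ⟨y, hy, hyx⟩ := (h2.and (Ioo_mem_nhdsGT hx)).exists
  exact ((cdf_nonneg μ y).lt_of_ne (Ne.symm hy)).trans_le (monotone_cdf μ hyx.2.le)

theorem tendsto_neg_log_one_sub_div : Tendsto (fun u : ℝ => -Real.log (1 - u) / u) (𝓝[>] 0)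
    (𝓝 1) := by
  have h1 : HasDerivAt (fun u : ℝ => -Real.log (1 - u)) 1 0 := by
    have h2 : HasDerivAt (fun u : ℝ => 1 - u) (-1) 0 := by
      simpa using (hasDerivAt_id (0 : ℝ)).const_sub 1
    have h3 := (h2.log (by simp)).neg
    simp only [sub_zero, div_one, neg_neg] at h3
    exact h3
  have h4 := h1.tendsto_slope.mono_left (nhdsWithin_mono 0 fun x (hx : x ∈ Ioi 0) => ne_of_gt hx)
  refine h4.congr fun u => ?_
  simp [slope_def_field]

theorem eventually_cdf_lt_one (h0 : cdf μ 0 = 0) : ∀ᶠ s in 𝓝[>] 0, cdf μ s < 1 := by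
  have h1 := ((cdf μ).right_continuous 0).mono_left (nhdsWithin_mono 0 Ioi_subset_Ici_self)
  rw [h0] at h1
  exact h1.eventually (gt_mem_nhds one_pos)

/-- Since `-log (1 - u)` is equivalent to `u` at zero, `G [0, y]` inherits the asymptotics of `F y`.
-/
theorem tendsto_hazardMeasure_div {a C : ℝ} (ha : 0 < a) (hC : 0 < C) (h0 : cdf μ 0 = 0)
    (hF : (fun y => cdf μ y) ~[𝓝[>] 0] (fun y : ℝ => C * y ^ a)) :
    Tendsto (fun y => (hazardMeasure μ).real (Icc 0 y) / y ^ a) (𝓝[>] 0) (𝓝 C) := by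
  have h1 : Tendsto (fun y : ℝ => C * y ^ a) (𝓝[>] 0) (𝓝 0) := by
    have : Tendsto (fun y : ℝ => C * y ^ a) (𝓝 0) (𝓝 (C * 0 ^ a)) :=
      ((Real.continuousAt_rpow_const 0 a (Or.inr ha.le)).tendsto).const_mul C
    rw [Real.zero_rpow ha.ne', mul_zero] at this
    exact this.mono_left nhdsWithin_le_nhds
  have h2 : Tendsto (fun y => cdf μ y) (𝓝[>] 0) (𝓝[>] 0) := by
    refine tendsto_nhdsWithin_iff.2 ⟨hF.symm.tendsto_nhds h1, ?_⟩
    filter_upwards [self_mem_nhdsWithin] with y hy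
    exact cdf_pos_of_isEquivalent μ hC hF hy
  have h3 := tendsto_neg_log_one_sub_div.comp h2
  have h4 : Tendsto (fun y => cdf μ y / (C * y ^ a)) (𝓝[>] 0) (𝓝 1) := by
    refine (isEquivalent_iff_tendsto_one ?_).1 hF
    filter_upwards [self_mem_nhdsWithin] with y hy
    exact (mul_pos hC (Real.rpow_pos_of_pos hy a)).ne'
  have h5 := (h3.mul h4).mul_const C
  rw [one_mul, one_mul] at h5
  have h6 : ∀ᶠ y in 𝓝[>] 0, cdf μ y < 1 :=
    (h2.mono_right nhdsWithin_le_nhds).eventually (gt_mem_nhds one_pos)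
  refine h5.congr' ?_
  filter_upwards [self_mem_nhdsWithin, h6] with y hy hy1
  have hpos := cdf_pos_of_isEquivalent μ hC hF hy
  have hya : 0 < y ^ a := Real.rpow_pos_of_pos hy a
  rw [measureReal_def, hazardMeasure_Icc μ y h0, if_pos hy1, ENNReal.toReal_ofReal]
  · simp only [Function.comp_apply]
    field_simp
  · have := Real.log_nonpos (by linarith : 0 ≤ 1 - cdf μ y) (by linarith)
    linarith

/-- `G [0, s x] / G [0, s] → x ^ a` as `s → 0`. -/
theorem tendsto_hazardMeasure_ratio {a C : ℝ} (ha : 0 < a) (hC : 0 < C) (h0 : cdf μ 0 = 0)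
    (hF : (fun y => cdf μ y) ~[𝓝[>] 0] (fun y : ℝ => C * y ^ a)) {x : ℝ} (hx : 0 ≤ x) :
    Tendsto (fun s => (hazardMeasure μ).real (Icc 0 (s * x)) / (hazardMeasure μ).real (Icc 0 s))
      (𝓝[>] 0) (𝓝 (x ^ a)) := by
  rcases hx.eq_or_lt with rfl | hx
  · have : (hazardMeasure μ).real {0} = 0 := by
      rw [measureReal_def, hazardMeasure_singleton_zero μ h0, ENNReal.toReal_zero]
    simp [Real.zero_rpow ha.ne', this]
  have h1 := tendsto_hazardMeasure_div μ ha hC h0 hF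
  have hsx : Tendsto (fun s : ℝ => s * x) (𝓝[>] 0) (𝓝[>] 0) := by
    refine tendsto_nhdsWithin_iff.2 ⟨?_, ?_⟩
    · have : Tendsto (fun s : ℝ => s * x) (𝓝 0) (𝓝 (0 * x)) := tendsto_id.mul_const x
      rw [zero_mul] at this
      exact this.mono_left nhdsWithin_le_nhds
    · filter_upwards [self_mem_nhdsWithin] with s hs
      exact mul_pos hs hx
  have h2 := ((h1.comp hsx).div h1 hC.ne').mul_const (x ^ a)
  rw [div_self hC.ne', one_mul] at h2
  refine h2.congr' ?_
  filter_upwards [self_mem_nhdsWithin] with s hs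
  have hsa : s ^ a ≠ 0 := (Real.rpow_pos_of_pos hs a).ne'
  have hxa : x ^ a ≠ 0 := (Real.rpow_pos_of_pos hx a).ne'
  rw [Pi.div_apply, Function.comp_apply]
  rw [Real.mul_rpow (le_of_lt hs) hx.le]
  rcases eq_or_ne ((hazardMeasure μ).real (Icc 0 s)) 0 with hz | hz
  · simp [hz]
  · field_simp

/-- Numerator and denominator are both divided by `G [0, s]`. The ratios are then at most `1` by
monotonicity and converge to powers, so dominated convergence applies. -/
theorem tendsto_stepCDF {a C : ℝ} (ha : 0 < a) (hC : 0 < C) (h0 : cdf μ 0 = 0)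
    (hF : (fun y => cdf μ y) ~[𝓝[>] 0] (fun y : ℝ => C * y ^ a)) {b : ℝ} (hb0 : 0 ≤ b)
    (hb : b ≤ 1) :
    Tendsto (fun s => stepCDF (hazardMeasure μ) s b) (𝓝[>] 0)
      (𝓝 ((a + 1) * b ^ a - a * b ^ (a + 1))) := by
  have hsmall := eventually_cdf_lt_one μ h0
  have hint : ∀ c : ℝ, 0 ≤ c → c ≤ 1 → Tendsto (fun s => ∫ t in (0 : ℝ)..c,
      (hazardMeasure μ).real (Icc 0 (s * t)) / (hazardMeasure μ).real (Icc 0 s)) (𝓝[>] 0)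
      (𝓝 (c ^ (a + 1) / (a + 1))) := by
    intro c hc0 hc1
    have hlim : ∫ t in (0 : ℝ)..c, t ^ a = c ^ (a + 1) / (a + 1) := by
      rw [integral_rpow (Or.inl (by linarith)), Real.zero_rpow (by linarith), sub_zero]
    rw [← hlim]
    refine intervalIntegral.tendsto_integral_filter_of_dominated_convergence (fun _ => 1) ?_ ?_
      intervalIntegrable_const ?_
    · filter_upwards [self_mem_nhdsWithin] with s hs
      refine Measurable.aestronglyMeasurable ?_
      exact (measurable_measure_Icc _ s hs).ennreal_toReal.div_const _
    · filter_upwards [self_mem_nhdsWithin, hsmall] with s hs hs1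
      refine ae_of_all _ fun t ht => ?_
      rw [uIoc_of_le hc0] at ht
      rw [Real.norm_of_nonneg (div_nonneg measureReal_nonneg measureReal_nonneg)]
      refine div_le_one_of_le₀ ?_ measureReal_nonneg
      have hs' : (0 : ℝ) < s := hs
      exact measureReal_mono (Icc_subset_Icc_right
        (mul_le_of_le_one_right hs'.le (ht.2.trans hc1))) (hazardMeasure_Icc_ne_top μ h0 hs1)
    · refine ae_of_all _ fun t ht => ?_
      rw [uIoc_of_le hc0] at ht
      exact tendsto_hazardMeasure_ratio μ ha hC h0 hF ht.1.le
  have hnum := ((tendsto_hazardMeasure_ratio μ ha hC h0 hF hb0).const_mul (1 - b)).add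
    (hint b hb0 hb)
  have hden := hint 1 zero_le_one le_rfl
  rw [Real.one_rpow] at hden
  have hquot := hnum.div hden (by positivity)
  have hval : ((1 - b) * b ^ a + b ^ (a + 1) / (a + 1)) / (1 / (a + 1)) =
      (a + 1) * b ^ a - a * b ^ (a + 1) := by
    rw [Real.rpow_add_one' hb0 (by linarith)]
    field_simp
    ring
  rw [hval] at hquot
  refine hquot.congr' ?_
  filter_upwards [self_mem_nhdsWithin, hsmall] with s hs hs1
  have hpos : (hazardMeasure μ).real (Icc 0 s) ≠ 0 := by
    refine (ENNReal.toReal_pos ?_ (hazardMeasure_Icc_ne_top μ h0 hs1)).ne'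
    exact (hazardMeasure_Icc_pos μ h0 (cdf_pos_of_isEquivalent μ hC hF hs)).ne'
  rw [stepCDF, Pi.div_apply]
  simp only [intervalIntegral.integral_div]
  rw [← mul_div_assoc, ← add_div, div_div_div_cancel_right₀ hpos]

end Hazard

/-! ### The cdf of Beta(a, 2) -/

section Beta

theorem beta_two {a : ℝ} (ha : 0 < a) : beta a 2 = 1 / (a * (a + 1)) := by
  have h2 : a + 2 = a + 1 + 1 := by ring
  have hG := Real.Gamma_pos_of_pos ha
  rw [beta, Real.Gamma_two, h2, Real.Gamma_add_one (by linarith), Real.Gamma_add_one ha.ne']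
  field_simp

theorem betaMeasure_Iic {a b : ℝ} (ha : 0 < a) (hb0 : 0 ≤ b) (hb : b ≤ 1) :
    (betaMeasure a 2).real (Iic b) = (a + 1) * b ^ a - a * b ^ (a + 1) := by
  have h1 : betaMeasure a 2 (Iic b) =
      ∫⁻ x in Ioo 0 b, ENNReal.ofReal (a * (a + 1) * (x ^ (a - 1) - x ^ a)) := by
    rw [betaMeasure, withDensity_apply _ measurableSet_Iic, ← lintegral_indicator measurableSet_Iic,
      ← lintegral_indicator measurableSet_Ioo]
    refine lintegral_congr_ae ?_
    have hne : ∀ᵐ x : ℝ, x ≠ b := by simp [ae_iff, measure_singleton]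
    filter_upwards [hne] with x hxb
    by_cases hx : x ∈ Ioo 0 b
    · rw [indicator_of_mem hx, indicator_of_mem (show x ∈ Iic b from hx.2.le),
        betaPDF_of_pos_lt_one hx.1 (hx.2.trans_le hb), beta_two ha]
      congr 1
      have h3 : x ^ a = x ^ (a - 1) * x := by
        rw [← Real.rpow_add_one hx.1.ne', sub_add_cancel]
      rw [h3, show (2 : ℝ) - 1 = 1 by norm_num, Real.rpow_one]
      field_simp
    · rw [indicator_of_notMem hx]
      by_cases hxb' : x ∈ Iic b
      · rw [indicator_of_mem hxb', betaPDF_eq_zero_of_nonpos]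
        by_contra hx0
        exact hx ⟨not_le.1 hx0, lt_of_le_of_ne hxb' hxb⟩
      · rw [indicator_of_notMem hxb']
  have hii : ∀ r : ℝ, -1 < r → IntervalIntegrable (fun x : ℝ => x ^ r) volume 0 b := fun r hr =>
    intervalIntegral.intervalIntegrable_rpow' hr
  have h4 : ∫ x in (0 : ℝ)..b, a * (a + 1) * (x ^ (a - 1) - x ^ a) =
      (a + 1) * b ^ a - a * b ^ (a + 1) := by
    rw [intervalIntegral.integral_const_mul, intervalIntegral.integral_sub (hii _ (by linarith))
      (hii _ (by linarith)), integral_rpow (Or.inl (by linarith)),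
      integral_rpow (Or.inl (by linarith)), sub_add_cancel, Real.zero_rpow ha.ne',
      Real.zero_rpow (by linarith)]
    field_simp
    ring
  rw [measureReal_def, h1, ← h4, intervalIntegral.integral_of_le hb0, integral_Ioc_eq_integral_Ioo,
    integral_eq_lintegral_of_nonneg_ae]
  · refine (ae_restrict_iff' measurableSet_Ioo).2 (ae_of_all _ fun x hx => ?_)
    have h3 : x ^ a = x ^ (a - 1) * x := by
      rw [← Real.rpow_add_one hx.1.ne', sub_add_cancel]
    have h5 : 0 ≤ x ^ (a - 1) * (1 - x) :=
      mul_nonneg (Real.rpow_nonneg hx.1.le _) (by linarith [hx.2])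
    change 0 ≤ a * (a + 1) * (x ^ (a - 1) - x ^ a)
    rw [h3]
    have : x ^ (a - 1) - x ^ (a - 1) * x = x ^ (a - 1) * (1 - x) := by ring
    rw [this]
    positivity
  · exact Measurable.aestronglyMeasurable (by fun_prop)

end Beta

/-! ### Weak convergence from convergence of cdfs -/

section Convergence

/-- Half-open intervals form a π-system containing small neighbourhoods of every point. Convergence
is asked at every `x`, which is available here because it holds at all points for the Beta limit. -/
theorem tendsto_of_tendsto_cdf {ι : Type*} {l : Filter ι} [l.IsCountablyGenerated]
    {m : ι → ProbabilityMeasure ℝ} {m₀ : ProbabilityMeasure ℝ}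
    (h : ∀ x, Tendsto (fun i => (m i : Measure ℝ).real (Iic x)) l
      (𝓝 ((m₀ : Measure ℝ).real (Iic x)))) : Tendsto m l (𝓝 m₀) := by
  refine IsPiSystem.tendsto_probabilityMeasure_of_tendsto_of_mem
    (S := {s : Set ℝ | ∃ a b, s = Ioc a b}) ?_ ?_ ?_ ?_
  · rintro _ ⟨a, b, rfl⟩ _ ⟨a', b', rfl⟩ -
    exact ⟨_, _, Ioc_inter_Ioc⟩
  · rintro _ ⟨a, b, rfl⟩
    exact measurableSet_Ioc
  · intro u hu x hx
    obtain ⟨ε, hε, hball⟩ := Metric.isOpen_iff.1 hu x hx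
    refine ⟨Ioc (x - ε / 2) (x + ε / 2), ⟨_, _, rfl⟩,
      Ioc_mem_nhds (by linarith) (by linarith), fun y hy => hball ?_⟩
    rw [Metric.mem_ball, Real.dist_eq, abs_lt]
    constructor <;> linarith [hy.1, hy.2]
  · rintro _ ⟨a, b, rfl⟩
    rw [← NNReal.tendsto_coe]
    change Tendsto (fun i => (m i : Measure ℝ).real (Ioc a b)) l
      (𝓝 ((m₀ : Measure ℝ).real (Ioc a b)))
    rcases le_or_gt b a with hab | hab
    · rw [Ioc_eq_empty (not_lt.2 hab)]
      simpa using tendsto_const_nhds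
    · have hsub : ∀ n : ProbabilityMeasure ℝ, (n : Measure ℝ).real (Ioc a b) =
          (n : Measure ℝ).real (Iic b) - (n : Measure ℝ).real (Iic a) := fun n => by
        have : Ioc a b = Iic b \ Iic a := by
          ext y; simp [and_comm]
        rw [this, measureReal_sdiff (Iic_subset_Iic.2 hab.le) measurableSet_Iic]
      simp_rw [hsub]
      exact (h b).sub (h a)

theorem measureReal_Iic_of_Icc {m : Measure ℝ} [IsProbabilityMeasure m] (hm : m (Icc 0 1) = 1) :
    (∀ x < 0, m.real (Iic x) = 0) ∧ ∀ x, 1 ≤ x → m.real (Iic x) = 1 := by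
  have hc : m (Icc 0 1)ᶜ = 0 := (prob_compl_eq_zero_iff measurableSet_Icc).2 hm
  constructor
  · intro x hx
    rw [measureReal_def, measure_mono_null _ hc, ENNReal.toReal_zero]
    intro y (hy : y ≤ x) h'
    linarith [h'.1]
  · intro x hx
    have : m (Iic x) = 1 := le_antisymm prob_le_one
      (hm ▸ measure_mono fun y hy => hy.2.trans hx)
    rw [measureReal_def, this, ENNReal.toReal_one]

theorem betaMeasure_Icc {a : ℝ} (ha : 0 < a) : betaMeasure a 2 (Icc 0 1) = 1 := by
  have := isProbabilityMeasureBeta ha two_pos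
  refine (prob_compl_eq_zero_iff measurableSet_Icc).1 ?_
  rw [betaMeasure, withDensity_apply _ measurableSet_Icc.compl]
  refine (setLIntegral_congr_fun measurableSet_Icc.compl fun x hx => ?_).trans lintegral_zero
  by_cases h0 : x ≤ 0
  · exact betaPDF_eq_zero_of_nonpos h0
  · refine betaPDF_eq_zero_of_one_le ?_
    by_contra h1
    exact hx ⟨(not_le.1 h0).le, (not_le.1 h1).le⟩

/-- `stepLaw G s` converges weakly to `Beta(a, 2)` as `s → 0`. -/
theorem tendsto_stepLaw (μ : Measure ℝ) {a C : ℝ} (ha : 0 < a)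
    (hC : 0 < C) (h0 : cdf μ 0 = 0)
    (hF : (fun y => cdf μ y) ~[𝓝[>] 0] (fun y : ℝ => C * y ^ a)) :
    Tendsto (β := ProbabilityMeasure ℝ)
      (fun s => ⟨stepLaw (hazardMeasure μ) s, isProbabilityMeasure_stepLaw _ s⟩) (𝓝[>] 0)
      (𝓝 ⟨betaMeasure a 2, isProbabilityMeasureBeta ha two_pos⟩) := by
  have hbeta := isProbabilityMeasureBeta ha two_pos
  have hpos : ∀ x > 0, 0 < hazardMeasure μ (Icc 0 x) := fun x hx =>
    hazardMeasure_Icc_pos μ h0 (cdf_pos_of_isEquivalent μ hC hF hx)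
  have hsmall := eventually_cdf_lt_one μ h0
  refine tendsto_of_tendsto_cdf fun x => ?_
  change Tendsto (fun s => (stepLaw (hazardMeasure μ) s).real (Iic x)) _
    (𝓝 ((betaMeasure a 2).real (Iic x)))
  rcases lt_or_ge x 0 with hx0 | hx0
  · rw [(measureReal_Iic_of_Icc (betaMeasure_Icc ha)).1 x hx0]
    refine tendsto_const_nhds.congr' ?_
    filter_upwards [self_mem_nhdsWithin, hsmall] with s hs hs1
    exact ((measureReal_Iic_of_Icc (stepLaw_Icc _ hs (hazardMeasure_Icc_ne_top μ h0 hs1)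
      hpos)).1 x hx0).symm
  rcases le_or_gt 1 x with hx1 | hx1
  · rw [(measureReal_Iic_of_Icc (betaMeasure_Icc ha)).2 x hx1]
    refine tendsto_const_nhds.congr' ?_
    filter_upwards [self_mem_nhdsWithin, hsmall] with s hs hs1
    exact ((measureReal_Iic_of_Icc (stepLaw_Icc _ hs (hazardMeasure_Icc_ne_top μ h0 hs1)
      hpos)).2 x hx1).symm
  · rw [betaMeasure_Iic ha hx0 hx1.le]
    refine (tendsto_stepCDF μ ha hC h0 hF hx0 hx1.le).congr' ?_
    filter_upwards [self_mem_nhdsWithin, hsmall] with s hs hs1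
    rw [← cdf_eq_real, cdf_stepLaw _ hs (hazardMeasure_Icc_ne_top μ h0 hs1) hpos hx0 hx1.le]

end Convergence

/-! ### Conditional law of the ratio of heights -/

section ConditionalLaw

theorem measurableSet_window (w : EReal) (h : ℝ) : MeasurableSet (window w h) := by
  have h1 : MeasurableSet {p : ℝ × ℝ | 0 < p.1} := measurableSet_lt measurable_const measurable_fst
  have h2 : Measurable fun p : ℝ × ℝ => (p.1 : EReal) :=
    measurable_coe_real_ereal.comp measurable_fst
  have h3 : MeasurableSet {p : ℝ × ℝ | 0 < p.2} := measurableSet_lt measurable_const measurable_snd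
  have h4 : MeasurableSet {p : ℝ × ℝ | p.2 < h} := measurableSet_lt measurable_snd measurable_const
  exact h1.inter ((h2 measurableSet_Iio).inter (h3.inter h4))

theorem restrict_window (G : Measure ℝ) [SFinite G] (c : ℝ≥0∞) (w : EReal) (h : ℝ) :
    (c • ((volume.restrict (Ioi (0 : ℝ))).prod G)).restrict (window w h) =
      stripIntensity c w (G.restrict (Ioo 0 h)) := by
  have hw : window w h = {x : ℝ | 0 < x ∧ (x : EReal) < w} ×ˢ Ioo 0 h := by
    ext p
    simp only [window, mem_ofPred_eq, mem_prod, mem_Ioo, and_assoc]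
  have hsub : {x : ℝ | 0 < x ∧ (x : EReal) < w} ⊆ Ioi 0 := fun x hx => hx.1
  rw [Measure.restrict_smul, hw, ← Measure.prod_restrict,
    Measure.restrict_restrict (measurableSet_abscissae w), inter_eq_left.2 hsub, stripIntensity]

/-- The weight `ENNReal.ofReal (s - y)` vanishes above `s`, so the height `h` of the window leaves
no trace. -/
theorem lintegral_restrict_Ioo_eq (G : Measure ℝ) (hG0 : G {0} = 0) {s h : ℝ} (hs : s < h)
    (f : ℝ → ℝ≥0∞) : ∫⁻ y in Ioo 0 h, ENNReal.ofReal (s - y) * f y ∂G =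
      ∫⁻ y in Icc 0 s, ENNReal.ofReal (s - y) * f y ∂G := by
  rw [← lintegral_indicator measurableSet_Ioo, ← lintegral_indicator measurableSet_Icc]
  have hne : ∀ᵐ y ∂G, y ≠ 0 := by
    rw [ae_iff]
    simpa using hG0
  refine lintegral_congr_ae ?_
  filter_upwards [hne] with y hy
  by_cases hys : y ∈ Icc 0 s
  · rw [indicator_of_mem hys,
      indicator_of_mem (show y ∈ Ioo 0 h from ⟨hys.1.lt_of_ne (Ne.symm hy), hys.2.trans_lt hs⟩)]
  · rw [indicator_of_notMem hys]
    by_cases hyh : y ∈ Ioo 0 h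
    · rw [indicator_of_mem hyh, ENNReal.ofReal_of_nonpos, zero_mul]
      by_contra hlt
      exact hys ⟨hyh.1.le, by linarith⟩
    · rw [indicator_of_notMem hyh]

variable {Ω : Type*} [MeasurableSpace Ω] {P : Measure Ω}

theorem lintegral_cond {E : Set Ω} (hE : NullMeasurableSet E P) (f : Ω → ℝ≥0∞) :
    ∫⁻ ω, f ω ∂P[|E] = (P E)⁻¹ * ∫⁻ ω, E.indicator f ω ∂P := by
  rw [ProbabilityTheory.cond, lintegral_smul_measure, smul_eq_mul, lintegral_indicator₀ hE]

variable [IsProbabilityMeasure P] {Φ : Ω → Set (ℝ × ℝ)} {c : ℝ≥0∞} {G : Measure ℝ} [SFinite G]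
  {h : ℝ} {w : EReal}

/-- The event agrees with a measurable one only where the point set is locally finite, that is, up
to a null set. -/
theorem nullMeasurableSet_hasStepWithin {ν : Measure ℝ} [IsFiniteMeasure ν]
    (hΦ : IsPoissonPointProcess Φ (stripIntensity c w ν) P)
    (hsub : ∀ ω, Φ ω ⊆ window w h) (hc : c ≠ ∞) (i : ℕ) :
    NullMeasurableSet {ω | HasStepWithin (Φ ω) w i} P := by
  classical
  have h1 := (aemeasurable_step hΦ hsub hc i (g := fun _ => 1) measurable_const).nullMeasurable
    (measurableSet_singleton 1)
  convert h1 using 1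
  ext ω
  by_cases hω : HasStepWithin (Φ ω) w i <;> simp [hω]

theorem ae_cond_height {ν : Measure ℝ} [IsFiniteMeasure ν]
    (hΦ : IsPoissonPointProcess Φ (stripIntensity c w ν) P)
    (hsub : ∀ ω, Φ ω ⊆ window w h) (hc : c ≠ ∞) (i : ℕ) :
    ∀ᵐ ω ∂P[|{ω | HasStepWithin (Φ ω) w i}], HasStepWithin (Φ ω) w i ∧
      0 ≤ vertexHeight (Φ ω) i ∧ 0 ≤ vertexHeight (Φ ω) (i + 1) := by
  have hE := nullMeasurableSet_hasStepWithin hΦ hsub hc i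
  rw [ProbabilityTheory.cond]
  refine Measure.ae_smul_measure ?_ _
  filter_upwards [ae_restrict_mem₀ hE] with ω hω
  have hω' : HasStepWithin (Φ ω) w i := hω
  refine ⟨hω', ?_⟩
  obtain ⟨p, q, hp, hq, -⟩ := hω'
  rw [vertexHeight_eq hp, vertexHeight_eq hq]
  exact ⟨(hsub ω hp.1.1).2.2.1.le, (hsub ω hq.1.1).2.2.1.le⟩

theorem aemeasurable_vertexHeight {ν : Measure ℝ} [IsFiniteMeasure ν]
    (hΦ : IsPoissonPointProcess Φ (stripIntensity c w ν) P)
    (hsub : ∀ ω, Φ ω ⊆ window w h) (hc : c ≠ ∞) (i : ℕ) :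
    AEMeasurable (fun ω => vertexHeight (Φ ω) i) P[|{ω | HasStepWithin (Φ ω) w i}] ∧
      AEMeasurable (fun ω => vertexHeight (Φ ω) (i + 1)) P[|{ω | HasStepWithin (Φ ω) w i}] := by
  classical
  have hac : P[|{ω | HasStepWithin (Φ ω) w i}] ≪ P := by
    rw [ProbabilityTheory.cond]
    exact (Measure.smul_absolutelyContinuous).trans Measure.restrict_le_self.absolutelyContinuous
  have h1 := (aemeasurable_step hΦ hsub hc i (g := fun x => ENNReal.ofReal x.1)
    (by fun_prop)).ennreal_toReal.mono_ac hac
  have h2 := (aemeasurable_step hΦ hsub hc i (g := fun x => ENNReal.ofReal x.2)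
    (by fun_prop)).ennreal_toReal.mono_ac hac
  refine ⟨h1.congr ?_, h2.congr ?_⟩
  · filter_upwards [ae_cond_height hΦ hsub hc i] with ω hω
    rw [if_pos hω.1, ENNReal.toReal_ofReal hω.2.1]
  · filter_upwards [ae_cond_height hΦ hsub hc i] with ω hω
    rw [if_pos hω.1, ENNReal.toReal_ofReal hω.2.2]

/-- The conditional law of the ratio of two consecutive heights. -/
theorem condDistrib_height_ratio (hGtop : G (Icc 0 h) ≠ ∞) (hG0 : G {0} = 0)
    (hpos : ∀ x > 0, 0 < G (Icc 0 x))
    (hΦ : IsPoissonPointProcess Φ (stripIntensity c w (G.restrict (Ioo 0 h))) P)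
    (hsub : ∀ ω, Φ ω ⊆ window w h) (hc : c ≠ ∞) (i : ℕ) :
    condDistrib (fun ω => vertexHeight (Φ ω) (i + 1) / vertexHeight (Φ ω) i)
      (fun ω => vertexHeight (Φ ω) i) P[|{ω | HasStepWithin (Φ ω) w i}] =ᵐ[
        P[|{ω | HasStepWithin (Φ ω) w i}].map fun ω => vertexHeight (Φ ω) i] stepKernel G := by
  classical
  have hfin : IsFiniteMeasure (G.restrict (Ioo 0 h)) := ⟨by
    rw [Measure.restrict_apply_univ]
    exact (measure_mono Ioo_subset_Icc_self).trans_lt hGtop.lt_top⟩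
  have hν : G.restrict (Ioo 0 h) (Ioo 0 h)ᶜ = 0 := by
    rw [Measure.restrict_apply measurableSet_Ioo.compl, compl_inter_self, measure_empty]
  have hE := nullMeasurableSet_hasStepWithin hΦ hsub hc i
  obtain ⟨hY, hY'⟩ := aemeasurable_vertexHeight hΦ hsub hc i
  have hB := hY'.div hY
  -- It suffices to identify the joint law of the height and the ratio with the composition product
  -- of the law of the height and `stepKernel G`.
  refine condDistrib_ae_eq_of_measure_eq_compProd _ hB ?_
  ext A hA
  have hYB := hY.prodMk hB
  have hfm : Measurable fun x : ℝ × ℝ => A.indicator (1 : ℝ × ℝ → ℝ≥0∞) (x.1, x.2 / x.1) :=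
    (measurable_one.indicator hA).comp (by fun_prop)
  have hκ : Measurable fun s => stepKernel G s (Prod.mk s ⁻¹' A) :=
    Kernel.measurable_kernel_prodMk_left hA
  have hκ' : Measurable fun x : ℝ × ℝ => stepKernel G x.1 (Prod.mk x.1 ⁻¹' A) :=
    hκ.comp measurable_fst
  rw [Measure.compProd_apply hA, lintegral_map' hκ.aemeasurable hY, lintegral_cond hE,
    ← lintegral_indicator_one hA, lintegral_map' (measurable_one.indicator hA).aemeasurable hYB,
    lintegral_cond hE]
  congr 1
  -- The product formula is used twice, for the indicator of `A` and for its average under the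
  -- kernel. The factors in `p` coincide, so only the integrals over `y` have to be compared.
  have e1 := lintegral_step_eq hΦ hsub hc hν i hfm
  have e2 := lintegral_step_eq hΦ hsub hc hν i hκ'
  simp only [indicator, mem_ofPred_eq] at e1 ⊢
  refine e1.trans (Eq.trans ?_ e2.symm)
  refine lintegral_congr_ae ?_
  filter_upwards [ae_stripIntensity_mem_window hν] with p hp
  congr 1
  obtain ⟨-, -, hs, hsh⟩ := hp
  have hGs : G (Icc 0 p.2) ≠ ∞ :=
    ((measure_mono (Icc_subset_Icc_right hsh.le)).trans_lt hGtop.lt_top).ne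
  obtain ⟨hm0, hm1⟩ := stepMeasure_univ_ne G hs hGs hpos
  have hAs : MeasurableSet (Prod.mk p.2 ⁻¹' A) := measurable_prodMk_left hA
  have e3 := lintegral_restrict_Ioo_eq G hG0 hsh
    (fun y => (Prod.mk p.2 ⁻¹' A).indicator 1 (y / p.2))
  have e4 := lintegral_restrict_Ioo_eq G hG0 hsh
    (fun _ => stepKernel G p.2 (Prod.mk p.2 ⁻¹' A))
  rw [← stepMeasure_apply G p.2 hAs] at e3
  have e5 := stepMeasure_apply G p.2 MeasurableSet.univ
  simp only [indicator_univ, Pi.one_apply, mul_one] at e5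
  rw [lintegral_mul_const (μ := G.restrict (Icc 0 p.2)) _ (by fun_prop), ← e5] at e4
  have e6 : stepMeasure G p.2 univ * stepKernel G p.2 (Prod.mk p.2 ⁻¹' A) =
      stepMeasure G p.2 (Prod.mk p.2 ⁻¹' A) := by
    change stepMeasure G p.2 univ * stepLaw G p.2 (Prod.mk p.2 ⁻¹' A) = _
    rw [stepLaw_apply G hm0 hm1, ← mul_assoc, ENNReal.mul_inv_cancel hm0 hm1, one_mul]
  rw [e4, e6, ← e3]
  rfl

/-- In an infinitely wide window each strip of heights below `ε` has infinite intensity, so almost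
surely there are arbitrarily low points and the sequence of vertices never stops. The intercept
condition is vacuous. -/
theorem ae_hasStepWithin_top (hGtop : G (Icc 0 h) ≠ ∞) (hh : 0 < h) (hG0 : G {0} = 0)
    (hpos : ∀ x > 0, 0 < G (Icc 0 x))
    (hΦ : IsPoissonPointProcess Φ (stripIntensity c ⊤ (G.restrict (Ioo 0 h))) P)
    (hsub : ∀ ω, Φ ω ⊆ window ⊤ h) (hc0 : c ≠ 0) (hc : c ≠ ∞) (i : ℕ) :
    ∀ᵐ ω ∂P, HasStepWithin (Φ ω) ⊤ i := by
  have hfin : IsFiniteMeasure (G.restrict (Ioo 0 h)) := ⟨by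
    rw [Measure.restrict_apply_univ]
    exact (measure_mono Ioo_subset_Icc_self).trans_lt hGtop.lt_top⟩
  have hlow : ∀ᵐ ω ∂P, ∀ k : ℕ, ∃ p ∈ Φ ω, p.2 < 1 / ((k : ℝ) + 1) := by
    refine ae_all_iff.2 fun k => ?_
    have hk : (0 : ℝ) < 1 / ((k : ℝ) + 1) := by positivity
    have hBeq : {p : ℝ × ℝ | p.2 < 1 / ((k : ℝ) + 1)} = univ ×ˢ Iio (1 / ((k : ℝ) + 1)) := by
      ext p; simp
    have hBm : MeasurableSet {p : ℝ × ℝ | p.2 < 1 / ((k : ℝ) + 1)} :=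
      measurableSet_lt measurable_snd measurable_const
    have hG : (G.restrict (Ioo 0 h)) (Iio (1 / ((k : ℝ) + 1))) ≠ 0 := by
      rw [Measure.restrict_apply measurableSet_Iio]
      have hm : 0 < min (1 / ((k : ℝ) + 1)) h / 2 := by
        have := lt_min hk hh
        linarith
      have h1 := hpos _ hm
      have h2 : Icc 0 (min (1 / ((k : ℝ) + 1)) h / 2) ⊆
          {0} ∪ (Iio (1 / ((k : ℝ) + 1)) ∩ Ioo 0 h) := by
        intro y hy
        rcases hy.1.eq_or_lt with h0 | h0
        · exact Or.inl h0.symm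
        · refine Or.inr ⟨?_, h0, ?_⟩
          · have := min_le_left (1 / ((k : ℝ) + 1)) h
            change y < _
            linarith [hy.2]
          · linarith [hy.2, min_le_right (1 / ((k : ℝ) + 1)) h]
      intro hzero
      exact h1.ne' (measure_mono_null h2 (measure_union_null hG0 hzero))
    have hΛ : stripIntensity c ⊤ (G.restrict (Ioo 0 h))
        {p : ℝ × ℝ | p.2 < 1 / ((k : ℝ) + 1)} = ∞ := by
      have hset : {x : ℝ | 0 < x ∧ (x : EReal) < ⊤} = Ioi 0 := by
        ext x
        simp [EReal.coe_lt_top]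
      rw [stripIntensity, Measure.smul_apply, hBeq, Measure.prod_prod, hset,
        Measure.restrict_apply_univ, Real.volume_Ioi, ENNReal.top_mul hG, smul_eq_mul,
        ENNReal.mul_top hc0]
    have hlaw := hΦ.hasLaw_count _ hBm
    have h3 : ∀ᵐ n ∂(P.map fun ω =>
        (Φ ω ∩ {p : ℝ × ℝ | p.2 < 1 / ((k : ℝ) + 1)}).encard), n = ⊤ := by
      rw [hlaw.map_eq, hΛ, poissonLaw, if_pos rfl]
      simp [ae_dirac_eq]
    filter_upwards [ae_of_ae_map hlaw.aemeasurable h3] with ω hω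
    have hne : (Φ ω ∩ {p : ℝ × ℝ | p.2 < 1 / ((k : ℝ) + 1)}).Nonempty := by
      rw [← encard_ne_zero, hω]
      simp
    obtain ⟨p, hp1, hp2⟩ := hne
    exact ⟨p, hp1, hp2⟩
  filter_upwards [hlow, ae_isLocallyFiniteInStrip hΦ hsub hc] with ω hω1 hω2
  have hex := hω2.exists_isVertexAt fun ε hε => by
    obtain ⟨k, hk⟩ := exists_nat_one_div_lt hε
    obtain ⟨p, hp, hpk⟩ := hω1 k
    exact ⟨p, hp, hpk.trans hk⟩
  obtain ⟨p, hp⟩ := hex i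
  obtain ⟨q, hq⟩ := hex (i + 1)
  exact ⟨p, q, hp, hq, EReal.coe_lt_top _⟩

end ConditionalLaw

end

theorem mainTheorem6 (μ : Measure ℝ) [IsProbabilityMeasure μ] [NullSingletonClass μ]
    (hμ : μ (Iic 0) = 0) (a C : ℝ) (ha : 0 < a) (hC : 0 < C)
    (hF : (fun y => cdf μ y) ~[𝓝[>] 0] (fun y : ℝ => C * y ^ a)) :
    ∃ I : ℝ → ProbabilityMeasure ℝ,
      -- `I s` is a distribution on `[0, 1]` with the stated cdf
      (∀ s : ℝ, 0 < s → cdf μ s < 1 → (I s : Measure ℝ) (Icc 0 1) = 1 ∧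
        ∀ b ∈ Icc (0 : ℝ) 1, cdf (I s : Measure ℝ) b = stepCDF (hazardMeasure μ) s b) ∧
      -- `I s` is the conditional law of the ratio of consecutive heights, given the first one
      (∀ (Ω : Type*) [MeasurableSpace Ω] (P : Measure Ω) [IsProbabilityMeasure P]
        (n : ℕ) (_ : 0 < n) (Φ : Ω → Set (ℝ × ℝ))
        (_ : IsPoissonPointProcess Φ
          ((n : ℝ≥0∞) • ((volume.restrict (Ioi (0 : ℝ))).prod (hazardMeasure μ))) P)
        (w : EReal) (_ : 0 < w) (h : ℝ) (_ : 0 < h) (_ : cdf μ h < 1) (i : ℕ)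
        (E : Set Ω) (_ : E = {ω | HasStepWithin (Φ ω ∩ window w h) w i})
        (Y B : Ω → ℝ) (_ : Y = fun ω => vertexHeight (Φ ω ∩ window w h) i)
        (_ : B = fun ω => vertexHeight (Φ ω ∩ window w h) (i + 1) /
          vertexHeight (Φ ω ∩ window w h) i),
        NullMeasurableSet E P ∧ (w = ⊤ → ∀ᵐ ω ∂P, ω ∈ E) ∧
        AEMeasurable Y P[|E] ∧ AEMeasurable B P[|E] ∧
        ∀ᵐ s ∂(P[|E].map Y), condDistrib B Y P[|E] s = (I s : Measure ℝ)) ∧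
      -- `I s` converges weakly to `Beta(a, 2)` as `s → 0`
      Tendsto I (𝓝[>] 0) (𝓝 ⟨betaMeasure a 2, isProbabilityMeasureBeta ha two_pos⟩) := by
  have h0 : cdf μ 0 = 0 := by
    rw [cdf_eq_real, measureReal_def, hμ, ENNReal.toReal_zero]
  have hpos : ∀ x > 0, 0 < hazardMeasure μ (Icc 0 x) := fun x hx =>
    hazardMeasure_Icc_pos μ h0 (cdf_pos_of_isEquivalent μ hC hF hx)
  have hG0 := hazardMeasure_singleton_zero μ h0
  refine ⟨fun s => ⟨stepLaw (hazardMeasure μ) s, isProbabilityMeasure_stepLaw _ s⟩, ?_, ?_,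
    tendsto_stepLaw μ ha hC h0 hF⟩
  · intro s hs hs1
    have htop := hazardMeasure_Icc_ne_top μ h0 hs1
    exact ⟨stepLaw_Icc _ hs htop hpos, fun b hb => cdf_stepLaw _ hs htop hpos hb.1 hb.2⟩
  · intro Ω _ P _ n hn Φ hΦ w hw h hh hFh i E hE Y B hY hB
    subst hE hY hB
    have htop := hazardMeasure_Icc_ne_top μ h0 hFh
    have hfin : IsFiniteMeasure ((hazardMeasure μ).restrict (Ioo 0 h)) := ⟨by
      rw [Measure.restrict_apply_univ]
      exact (measure_mono Ioo_subset_Icc_self).trans_lt htop.lt_top⟩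
    -- Restricting to the window gives a Poisson process on a strip; `cdf μ h < 1` makes the measure
    -- of heights finite there.
    have hΦ' := hΦ.inter (measurableSet_window w h)
    rw [restrict_window] at hΦ'
    have hsub : ∀ ω, Φ ω ∩ window w h ⊆ window w h := fun ω => inter_subset_right
    have hc : (n : ℝ≥0∞) ≠ ∞ := ENNReal.natCast_ne_top n
    have hc0 : (n : ℝ≥0∞) ≠ 0 := by exact_mod_cast hn.ne'
    obtain ⟨hY, hY'⟩ := aemeasurable_vertexHeight hΦ' hsub hc i
    refine ⟨nullMeasurableSet_hasStepWithin hΦ' hsub hc i, ?_, hY, hY'.div hY,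
      condDistrib_height_ratio htop hG0 hpos hΦ' hsub hc i⟩
    rintro rfl
    exact ae_hasStepWithin_top htop hh hG0 hpos hΦ' hsub hc0 hc i
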